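/- **Setting.** Let $m\ge 1$, $n\ge 2$, $A,B\in\mathbb R^{m\times n}$. In each round $t=1,2,\dots$ the optimizer plays $x_t\in\Delta_m$ as a (measurable) function of $y_1,\dots,y_{t-1}$ (an optimizer algorithm $\mathcal A_1$), and the learner plays $y_t\in\Delta_n$. The learner is a stochastic mirror ascent learner with noise $\xi_t\in\mathbb R^n$: $y_1$ is a fixed point of the relative interior of $\Delta_n$ and $$y_{t+1}\in\arg\min_{y\in\Delta_n}\bigl\{\eta_tD(y\|y_t)-(x_t^TB+\xi_t^T)y\bigr\},\qquad \eta_t>0,$$ where $D(y\|y')=\psi(y)-\psi(y')-\langle\nabla\psi(y'),y-y'\rangle$, $\psi$ is convex on a convex domain whose interior contains the relative interior of $\Delta_n$ (the $\arg\min$ is over the points of $\Delta_n$ in the domain), strictly convex on the part of $\Delta_n$ in the domain, differentiable on the relative interior of $\Delta_n$, and $\|\nabla_yD(y\|y')\|\to\infty$ when a coordinate of $y$ tends to $0$. The step sizes $\eta_t$ and $\psi$ are known to the optimizer and may depend on the horizon $T$. The entries $\xi_{t,i}$ are i.i.d. and $R$-sub-Gaussian, i.e. $\mathbb E e^{s\xi_{t,i}}\le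 e^{R^2s^2/2}$ for all $s\in\mathbb R$, with $R>0$. Put $Reg_2=\max_{y\in\Delta_n}\sum_{t\le T}x_t^TBy-\sum_{t\le T}x_t^TBy_t$. The learner is $f$-no-regret with constant $C$ at horizon $T$ if $\mathbb E[Reg_2]\le C f(T)$ against every optimizer algorithm. Put $StackReg_1=T\,V(A,B)-\sum_{t\le T}x_t^TAy_t$, where $V(A,B)=\max\{x^TAy: x\in\Delta_m,\ y\in\arg\max_{y'\in\Delta_n}x^TBy'\}$. For a matrix $B'$ let $\|B'\|_*=\max_{j,k}\|B'(e_j-e_k)\|_\infty$, and let $\mathcal B_i'^\circ$ be the $m\times(n-1)$ matrix with columns $B'(e_j-e_i)/\|B'\|_*$, $j\ne i$ (with $0/0=0$). Assume that $C_i:=\min_{x\in\Delta_m}\max_{j\neq i}x^T(\mathcal B_i^\circ)_{:,j}\neq0$ for all $i\in[n]$. **Algorithm.** Let $0<\delta<1$, $c\ge 8n/\|B\|_*$, $k=\lceil (T/g(T))^2\,2R^2\log(2mn/\delta)\rceil$. For $i=1,\dots,m$ in turn, play $e_i$ for $k+1$ rounds and set $\hat B_i=\frac1k\sum\eta_t\nabla_yD(y_{t+1}\|y_t)$,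 the sum being over the first $k$ of these rounds. Then play in all remaining rounds a fixed $\tilde x$ that, together with some $i$, maximizes $x^TA_{:,i}$ over $i\in[n]$ and $x\in\Delta_m$ with $(\hat{\mathcal B}_i^\circ)^Tx\le-\bigl(c\,\tfrac{g(T)}T+\tfrac{\sqrt{Tf(T)}}T\bigr)\mathbf 1$ (any measurable choice of a maximizer; $\tilde x\in\Delta_m$ is arbitrary if there is no feasible point). **Theorem.** For every $M>0$ there is a constant $K$, depending only on $A,B,C,R,\delta,c,M$, such that the following holds for all $f,g:\mathbb N\to\mathbb R$ with $f(T)=o(T)$, $g(T)=o(T)$, and, for all large $T$, $g(T)>0$ and $(T/g(T))^2\le M f(T)$. There is $T_0$ such that for every $T\ge T_0$ and every stochastic mirror ascent learner as above that is $f$-no-regret with constant $C$ at horizon $T$, the algorithm above satisfies $$StackReg_1\le K\Bigl(\sqrt{Tf(T)}+g(T)+\bigl(\tfrac T{g(T)}\bigr)^2\Bigr)$$ with probability at least $1-\delta$. Moreover there is an event $E$ of probability at least $1-\delta$, determined by the noise of the $m(k+1)$ exploration rounds, with $$\mathbb E[StackReg_1\mid E]\le K\Bigl(\sqrt{Tf(T)}+g(T)+\bigl(\tfrac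 T{g(T)}\bigr)^2\Bigr).$$ -/

import Mathlib

open MeasureTheory ProbabilityTheory Filter Asymptotics
open scoped Topology Matrix

noncomputable section

namespace Steering

/-- Borel (product) σ-algebra on matrices. -/
instance instMeasurableSpaceMatrix {m n : ℕ} : MeasurableSpace (Matrix (Fin m) (Fin n) ℝ) :=
  inferInstanceAs (MeasurableSpace (Fin m → Fin n → ℝ))

/-! ### The bimatrix game -/

/-- Bilinear payoff `xᵀ M y`. -/
def payoff {m n : ℕ} (M : Matrix (Fin m) (Fin n) ℝ) (x : Fin m → ℝ) (y : Fin n → ℝ) : ℝ :=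
  x ⬝ᵥ (M *ᵥ y)

/-- Best responses `BR(B, x)` of the learner to the mixed action `x`. -/
def bestResponses {m n : ℕ} (B : Matrix (Fin m) (Fin n) ℝ) (x : Fin m → ℝ) :
    Set (Fin n → ℝ) :=
  {y | y ∈ stdSimplex ℝ (Fin n) ∧
    ∀ y' ∈ stdSimplex ℝ (Fin n), payoff B x y' ≤ payoff B x y}

/-- Stackelberg value `V(A, B)` of the optimizer (ties broken in its favour). -/
def stackelbergValue {m n : ℕ} (A B : Matrix (Fin m) (Fin n) ℝ) : ℝ :=
  sSup {v | ∃ x ∈ stdSimplex ℝ (Fin m), ∃ y ∈ bestResponses B x, v = payoff A x y}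

/-- Learner regret of a trajectory over `T` rounds (rounds are numbered `0, …, T - 1`). -/
def learnerRegret {m n : ℕ} (B : Matrix (Fin m) (Fin n) ℝ) (T : ℕ)
    (x : ℕ → Fin m → ℝ) (y : ℕ → Fin n → ℝ) : ℝ :=
  (⨆ z : stdSimplex ℝ (Fin n), ∑ t ∈ Finset.range T, payoff B (x t) z)
    - ∑ t ∈ Finset.range T, payoff B (x t) (y t)

/-- Stackelberg regret of a trajectory over `T` rounds. -/
def stackelbergRegret {m n : ℕ} (A B : Matrix (Fin m) (Fin n) ℝ) (T : ℕ)
    (x : ℕ → Fin m → ℝ) (y : ℕ → Fin n → ℝ) : ℝ :=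
  T * stackelbergValue A B - ∑ t ∈ Finset.range T, payoff A (x t) (y t)

/-! ### Equivalence classes of payoff matrices -/

/-- `max_{j₁, j₂} ‖B_{:,j₁} - B_{:,j₂}‖_∞`. -/
def spread {m n : ℕ} (B : Matrix (Fin m) (Fin n) ℝ) : ℝ :=
  ⨆ p : Fin n × Fin n, ‖fun r : Fin m => B r p.1 - B r p.2‖

/-- The matrix `𝓑ᵢ°` that represents the equivalence class of `B` (with `0 / 0 = 0`); its columns
are indexed by the actions `j ≠ i`. -/
def classMatrix {m n : ℕ} (B : Matrix (Fin m) (Fin n) ℝ) (i : Fin n) :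
    Matrix (Fin m) {j : Fin n // j ≠ i} ℝ :=
  Matrix.of fun r j => (B r j - B r i) / spread B

/-- Inducibility gap `Cᵢ = min_{x ∈ Δ_m} max_j xᵀ (𝓑ᵢ°)_{:,j}`. -/
def inducibilityGap {m n : ℕ} (B : Matrix (Fin m) (Fin n) ℝ) (i : Fin n) : ℝ :=
  ⨅ x : stdSimplex ℝ (Fin m), ⨆ j : {j : Fin n // j ≠ i},
    ((x : Fin m → ℝ) ᵥ* classMatrix B i) j

/-- Pessimistic facet `Eᵢ⁻(𝓑, d) = {x ∈ Δ_m : (𝓑ᵢ°)ᵀ x ≤ -d 1}`. -/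
def pessimisticFacet {m n : ℕ} (B : Matrix (Fin m) (Fin n) ℝ) (i : Fin n) (d : ℝ) :
    Set (Fin m → ℝ) :=
  {x | x ∈ stdSimplex ℝ (Fin m) ∧ ∀ j : {j : Fin n // j ≠ i}, (x ᵥ* classMatrix B i) j ≤ -d}

/-- `x` (together with some `i`) solves: maximize `xᵀ A_{:,i}` over `i` and `x ∈ Eᵢ⁻(𝓑, d)`. -/
def SolvesPessimistic {m n : ℕ} (A B : Matrix (Fin m) (Fin n) ℝ) (d : ℝ) (x : Fin m → ℝ) :
    Prop :=
  ∃ i, x ∈ pessimisticFacet B i d ∧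
    ∀ i', ∀ x' ∈ pessimisticFacet B i' d, (x' ᵥ* A) i' ≤ (x ᵥ* A) i

/-! ### Bregman divergences and stochastic mirror ascent -/

/-- Relative interior of the simplex. -/
def openSimplex (n : ℕ) : Set (Fin n → ℝ) :=
  {y | y ∈ stdSimplex ℝ (Fin n) ∧ ∀ i, 0 < y i}

/-- Bregman divergence `D(y‖y') = ψ(y) - ψ(y') - ⟨∇ψ(y'), y - y'⟩`. -/
def bregman {n : ℕ} (ψ : (Fin n → ℝ) → ℝ) (y y' : Fin n → ℝ) : ℝ :=
  ψ y - ψ y' - fderiv ℝ ψ y' (y - y')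

/-- The gradient `∇_y D(y‖y')` in the first argument. -/
def gradBregman {n : ℕ} (ψ : (Fin n → ℝ) → ℝ) (y y' : Fin n → ℝ) : Fin n → ℝ :=
  fun i => fderiv ℝ (fun z => bregman ψ z y') y (Pi.single i 1)

/-- A regularizer `ψ` with convex domain `dom`: convex, strictly convex on the simplex,
differentiable at the relatively interior points of the simplex, and such that `∇_y D(y‖y')`
blows up when some coordinate of `y` tends to `0`. -/
structure IsRegularizer {n : ℕ} (ψ : (Fin n → ℝ) → ℝ) (dom : Set (Fin n → ℝ)) : Prop where
  convexOn : ConvexOn ℝ dom ψ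
  strictConvexOn : StrictConvexOn ℝ (stdSimplex ℝ (Fin n) ∩ dom) ψ
  subset_interior : openSimplex n ⊆ interior dom
  differentiableAt : ∀ y ∈ openSimplex n, DifferentiableAt ℝ ψ y
  blowup : ∀ y' ∈ openSimplex n, ∀ L : ℝ, ∃ ρ > 0, ∀ y ∈ openSimplex n,
    (∃ i, y i < ρ) → L ≤ ‖gradBregman ψ y y'‖

/-- An algorithm of the optimizer: a measurable rule that gives the action of round `t` from the
learner's actions in the rounds before `t`. -/
structure OptimizerAlgorithm (m n : ℕ) where
  act : ℕ → (ℕ → Fin n → ℝ) → Fin m → ℝ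
  act_mem : ∀ t h, act t h ∈ stdSimplex ℝ (Fin m)
  causal : ∀ t h h', (∀ s < t, h s = h' s) → act t h = act t h'
  measurable_act : ∀ t, Measurable (act t)

/-- Data of a mirror ascent learner: regularizer, its domain, step sizes and first action. -/
structure MirrorAscent (n : ℕ) where
  ψ : (Fin n → ℝ) → ℝ
  dom : Set (Fin n → ℝ)
  η : ℕ → ℝ
  y₁ : Fin n → ℝ
  isRegularizer : IsRegularizer ψ dom
  η_pos : ∀ t, 0 < η t
  y₁_mem : y₁ ∈ openSimplex n

/-- `x, y` are the actions when the optimizer uses `alg` and the learner follows the stochastic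
mirror ascent update
`y_{t+1} = argmin_{z ∈ Δ_n} {η_t D(z‖y_t) - (x_tᵀ B + ξ_tᵀ) z}` with noise `ξ`. -/
structure IsPlay {m n : ℕ} {Ω : Type*} [MeasurableSpace Ω] (B : Matrix (Fin m) (Fin n) ℝ)
    (learner : MirrorAscent n) (ξ : ℕ → Ω → Fin n → ℝ) (alg : OptimizerAlgorithm m n)
    (x : ℕ → Ω → Fin m → ℝ) (y : ℕ → Ω → Fin n → ℝ) : Prop where
  measurable_y : ∀ t, Measurable (y t)
  optimizer : ∀ t ω, x t ω = alg.act t (fun s => y s ω)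
  init : ∀ ω, y 0 ω = learner.y₁
  mem : ∀ t ω, y (t + 1) ω ∈ stdSimplex ℝ (Fin n) ∩ learner.dom
  update : ∀ t ω,
    IsMinOn (fun z => learner.η t * bregman learner.ψ z (y t ω) - (x t ω ᵥ* B + ξ t ω) ⬝ᵥ z)
      (stdSimplex ℝ (Fin n) ∩ learner.dom) (y (t + 1) ω)

/-- The entries `ξ_{t,i}` are i.i.d. and `R`-sub-Gaussian. -/
structure IsSubGaussianNoise {n : ℕ} {Ω : Type*} [MeasurableSpace Ω] (μ : Measure Ω)
    (ξ : ℕ → Ω → Fin n → ℝ) (R : ℝ) : Prop where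
  measurable : ∀ t, Measurable (ξ t)
  indep : iIndepFun (fun (p : ℕ × Fin n) ω => ξ p.1 ω p.2) μ
  ident : ∀ p q : ℕ × Fin n, IdentDistrib (fun ω => ξ p.1 ω p.2) (fun ω => ξ q.1 ω q.2) μ μ
  subgaussian : ∀ p : ℕ × Fin n,
    HasSubgaussianMGF (fun ω => ξ p.1 ω p.2) ⟨R ^ 2, sq_nonneg R⟩ μ

/-- Over `T` rounds the learner's expected regret is at most `b` against every algorithm of the
optimizer. -/
def HasRegretAtMost {m n : ℕ} {Ω : Type*} [MeasurableSpace Ω] (μ : Measure Ω)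
    (B : Matrix (Fin m) (Fin n) ℝ) (learner : MirrorAscent n) (ξ : ℕ → Ω → Fin n → ℝ)
    (T : ℕ) (b : ℝ) : Prop :=
  ∀ (alg : OptimizerAlgorithm m n) (x : ℕ → Ω → Fin m → ℝ) (y : ℕ → Ω → Fin n → ℝ),
    IsPlay B learner ξ alg x y →
      ∫ ω, learnerRegret B T (fun t => x t ω) (fun t => y t ω) ∂μ ≤ b

/-! ### The explore-then-commit algorithm -/

/-- The estimate `B̂`: block `i` consists of the `k + 1` rounds `i (k+1), …, i (k+1) + k`, and
`B̂ᵢ = (1/k) ∑ η_t ∇_y D(y_{t+1}‖y_t)` over the first `k` rounds of block `i`. -/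
def estimate (m : ℕ) {n : ℕ} (ψ : (Fin n → ℝ) → ℝ) (η : ℕ → ℝ) (k : ℕ)
    (h : ℕ → Fin n → ℝ) : Matrix (Fin m) (Fin n) ℝ :=
  Matrix.of fun i j => (1 / (k : ℝ)) * ∑ s ∈ Finset.range k,
    η ((i : ℕ) * (k + 1) + s) *
      gradBregman ψ (h ((i : ℕ) * (k + 1) + s + 1)) (h ((i : ℕ) * (k + 1) + s)) j

/-- The optimizer plays `e_i` in block `i` for `i = 0, …, m - 1`, and afterwards always
`commit B̂`. -/
def exploreCommitAct {m n : ℕ} (ψ : (Fin n → ℝ) → ℝ) (η : ℕ → ℝ) (k : ℕ)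
    (commit : Matrix (Fin m) (Fin n) ℝ → stdSimplex ℝ (Fin m)) (t : ℕ)
    (h : ℕ → Fin n → ℝ) : Fin m → ℝ :=
  if ht : t < m * (k + 1) then Pi.single ⟨t / (k + 1), Nat.div_lt_of_lt_mul (by
    rwa [mul_comm] at ht)⟩ 1
  else commit (estimate m ψ η k h)

theorem gradBregman_eq {n : ℕ} (ψ : (Fin n → ℝ) → ℝ) (y y' : Fin n → ℝ)
    (hy : DifferentiableAt ℝ ψ y) (i : Fin n) :
    gradBregman ψ y y' i
      = fderiv ℝ ψ y (Pi.single i 1) - fderiv ℝ ψ y' (Pi.single i 1) := by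
  have h1 : HasFDerivAt (fun z => bregman ψ z y') (fderiv ℝ ψ y - fderiv ℝ ψ y') y := by
    have h2 := (hy.hasFDerivAt.sub_const (ψ y')).sub
      ((fderiv ℝ ψ y').hasFDerivAt.comp y ((hasFDerivAt_id y).sub_const y'))
    exact h2
  simp [gradBregman, h1.fderiv]

theorem gradBregman_eq_zero {n : ℕ} (ψ : (Fin n → ℝ) → ℝ) (y y' : Fin n → ℝ)
    (hy : ¬ DifferentiableAt ℝ ψ y) (i : Fin n) : gradBregman ψ y y' i = 0 := by
  have : ¬ DifferentiableAt ℝ (fun z => bregman ψ z y') y := by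
    intro h
    apply hy
    have h2 : DifferentiableAt ℝ (fun z => ψ y' + fderiv ℝ ψ y' (z - y')) y := by fun_prop
    have h3 := h.add h2
    refine h3.congr_of_eventuallyEq (Eventually.of_forall fun z => ?_)
    simp [bregman]
  simp [gradBregman, fderiv_zero_of_not_differentiableAt this]

theorem measurable_gradBregman {n : ℕ} (ψ : (Fin n → ℝ) → ℝ) (i : Fin n) :
    Measurable fun p : (Fin n → ℝ) × (Fin n → ℝ) => gradBregman ψ p.1 p.2 i := by
  classical
  have h : (fun p : (Fin n → ℝ) × (Fin n → ℝ) => gradBregman ψ p.1 p.2 i)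
      = fun p => if p ∈ Prod.fst ⁻¹' {y | DifferentiableAt ℝ ψ y} then
          fderiv ℝ ψ p.1 (Pi.single i 1) - fderiv ℝ ψ p.2 (Pi.single i 1) else 0 := by
    funext p
    by_cases hp : DifferentiableAt ℝ ψ p.1
    · simp [hp, gradBregman_eq ψ p.1 p.2 hp i]
    · simp [hp, gradBregman_eq_zero ψ p.1 p.2 hp i]
  rw [h]
  have hm := measurable_fderiv_apply_const ℝ ψ (Pi.single i (1 : ℝ) : Fin n → ℝ)
  exact Measurable.ite (measurable_fst (measurableSet_of_differentiableAt ℝ ψ))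
    ((hm.comp measurable_fst).sub (hm.comp measurable_snd)) measurable_const

theorem measurable_estimate (m : ℕ) {n : ℕ} (ψ : (Fin n → ℝ) → ℝ) (η : ℕ → ℝ) (k : ℕ) :
    Measurable (estimate m ψ η k) := by
  refine measurable_pi_lambda _ fun i => measurable_pi_lambda _ fun j => ?_
  refine Measurable.const_mul (Finset.measurable_sum _ fun s _ => Measurable.const_mul ?_ _) _
  have hp : Measurable fun h : ℕ → Fin n → ℝ =>
      (h ((i : ℕ) * (k + 1) + s + 1), h ((i : ℕ) * (k + 1) + s)) :=
    (measurable_pi_apply _).prodMk (measurable_pi_apply _)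
  exact (measurable_gradBregman ψ j).comp hp

theorem estimate_congr (m : ℕ) {n : ℕ} (ψ : (Fin n → ℝ) → ℝ) (η : ℕ → ℝ) (k : ℕ)
    (h h' : ℕ → Fin n → ℝ) (hh : ∀ s < m * (k + 1), h s = h' s) :
    estimate m ψ η k h = estimate m ψ η k h' := by
  ext i j
  simp only [estimate, Matrix.of_apply]
  congr 1
  refine Finset.sum_congr rfl fun s hs => ?_
  have hs' := Finset.mem_range.1 hs
  have hi : ((i : ℕ) + 1) * (k + 1) ≤ m * (k + 1) := Nat.mul_le_mul_right _ i.2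
  have he : ((i : ℕ) + 1) * (k + 1) = (i : ℕ) * (k + 1) + (k + 1) := by ring
  rw [hh _ (by omega), hh _ (by omega)]

/-- The explore-then-commit algorithm with per-row exploration length `k` and commitment rule
`commit`. -/
def exploreCommit {m n : ℕ} (ψ : (Fin n → ℝ) → ℝ) (η : ℕ → ℝ) (k : ℕ)
    (commit : Matrix (Fin m) (Fin n) ℝ → stdSimplex ℝ (Fin m)) (hcommit : Measurable commit) :
    OptimizerAlgorithm m n where
  act := exploreCommitAct ψ η k commit
  act_mem t h := by
    unfold exploreCommitAct
    split_ifs with ht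
    · exact single_mem_stdSimplex ℝ _
    · exact (commit _).2
  causal t h h' hh := by
    unfold exploreCommitAct
    split_ifs with ht
    · rfl
    · rw [estimate_congr m ψ η k h h' fun s hs => hh s (lt_of_lt_of_le hs (not_lt.1 ht))]
  measurable_act t := by
    unfold exploreCommitAct
    split_ifs with ht
    · exact measurable_const
    · exact measurable_subtype_coe.comp (hcommit.comp (measurable_estimate m ψ η k))

/-- Per-row exploration length `k = ⌈(T / g(T))² · 2 R² log (2 m n / δ)⌉`. -/
def exploreLength (m n : ℕ) (R δ : ℝ) (g : ℕ → ℝ) (T : ℕ) : ℕ :=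
  ⌈((T : ℝ) / g T) ^ 2 * (2 * R ^ 2 * Real.log (2 * m * n / δ))⌉₊

/-- Margin `ε + f̃(T) / T` of the commitment, with `ε = c g(T) / T` and `f̃(T) = √(T f(T))`. -/
def commitMargin (c : ℝ) (f g : ℕ → ℝ) (T : ℕ) : ℝ :=
  c * (g T / T) + √(T * f T) / T

end Steering

end

/-!
The exploration rounds reveal `B` up to noise. Because the gradient of the regularizer blows up at
the boundary, every iterate of the learner lies in the relative interior of the simplex
(`IsRegularizer.argmin_mem_openSimplex`). The first order condition of the mirror ascent step then
says that the scaled gradient of the divergence equals `xᵀ B + ξᵀ` up to a multiple of the all-ones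
vector (`IsRegularizer.gradBregman_sub_eq`), and this multiple cancels in differences of columns.
By sub-Gaussian concentration the averaged noise is at most `2 g(T) / T` on an event `E` of
probability at least `1 - δ / 2`, so the class matrices are known up to `8 g(T) / (T spread B)`,
which the part `c g(T) / T` of the commitment margin absorbs.

Since no inducibility gap vanishes, every response that can be induced can be induced strictly.
Shrinking towards a strict point turns an optimal Stackelberg commitment into one with the required
margin, at a cost proportional to the margin (`SolvesPessimistic.mem_and_value_le`). On `E` the
committed action therefore nearly attains the Stackelberg value if the learner plays the intended
response, and each unit of mass on other responses costs the learner at least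
`√(T f(T)) / T * spread B`. Hence the Stackelberg regret is bounded by the exploration cost, the
margin cost and `√(T / f(T))` times the learner's regret, up to constants.

The learner's regret plus a multiple of the exploration length is nonnegative everywhere
(`learnerRegret_add_nonneg`) and has mean of order `f(T)`, as exploration lasts for
`O((T / g(T))²) = O(f(T))` rounds. So its contribution has mean of order `√(T f(T))`, also given
`E`, and Markov's inequality with the remaining probability `δ / 2` gives the tail bound.
-/

namespace Steering

/-! ### Payoffs -/

/-- Sum of the absolute values of the entries, a crude bound for all payoffs. -/
noncomputable def absSum {m n : ℕ} (M : Matrix (Fin m) (Fin n) ℝ) : ℝ := ∑ r, ∑ j, |M r j|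

lemma absSum_nonneg {m n : ℕ} (M : Matrix (Fin m) (Fin n) ℝ) : 0 ≤ absSum M :=
  Finset.sum_nonneg fun _ _ => Finset.sum_nonneg fun _ _ => abs_nonneg _

lemma le_one_of_mem_stdSimplex {ι : Type*} [Fintype ι] {x : ι → ℝ} (hx : x ∈ stdSimplex ℝ ι)
    (i : ι) : x i ≤ 1 := by
  rw [← hx.2]
  exact Finset.single_le_sum (fun j _ => hx.1 j) (Finset.mem_univ i)

lemma abs_vecMul_le {m n : ℕ} (M : Matrix (Fin m) (Fin n) ℝ) {x : Fin m → ℝ}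
    (hx : x ∈ stdSimplex ℝ (Fin m)) (j : Fin n) : |(x ᵥ* M) j| ≤ absSum M := by
  have h1 : |(x ᵥ* M) j| ≤ ∑ r, |M r j| := by
    have h := Finset.abs_sum_le_sum_abs (fun r => x r * M r j) Finset.univ
    refine le_trans h (Finset.sum_le_sum fun r _ => ?_)
    rw [abs_mul, abs_of_nonneg (hx.1 r)]
    exact mul_le_of_le_one_left (abs_nonneg _) (le_one_of_mem_stdSimplex hx r)
  refine h1.trans (Finset.sum_le_sum fun r _ => ?_)
  exact Finset.single_le_sum (f := fun j => |M r j|) (fun l _ => abs_nonneg (M r l))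
    (Finset.mem_univ j)

lemma payoff_eq_sum {m n : ℕ} (M : Matrix (Fin m) (Fin n) ℝ) (x : Fin m → ℝ) (y : Fin n → ℝ) :
    payoff M x y = ∑ j, (x ᵥ* M) j * y j := by
  rw [payoff, Matrix.dotProduct_mulVec]; rfl

lemma payoff_single {m n : ℕ} (M : Matrix (Fin m) (Fin n) ℝ) (x : Fin m → ℝ) (i : Fin n) :
    payoff M x (Pi.single i 1) = (x ᵥ* M) i := by
  simp [payoff_eq_sum, Pi.single_apply]

lemma sub_payoff {m n : ℕ} (M : Matrix (Fin m) (Fin n) ℝ) (x : Fin m → ℝ) {y : Fin n → ℝ}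
    (hy : y ∈ stdSimplex ℝ (Fin n)) (v : ℝ) :
    v - payoff M x y = ∑ j, (v - (x ᵥ* M) j) * y j := by
  simp only [payoff_eq_sum, sub_mul, Finset.sum_sub_distrib, ← Finset.mul_sum, hy.2, mul_one]

lemma payoff_le_of_forall {m n : ℕ} {M : Matrix (Fin m) (Fin n) ℝ} {x : Fin m → ℝ}
    {y : Fin n → ℝ} (hy : y ∈ stdSimplex ℝ (Fin n)) {v : ℝ} (h : ∀ j, (x ᵥ* M) j ≤ v) :
    payoff M x y ≤ v := by
  rw [← sub_nonneg, sub_payoff M x hy]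
  exact Finset.sum_nonneg fun j _ => mul_nonneg (sub_nonneg.2 (h j)) (hy.1 j)

lemma abs_payoff_le {m n : ℕ} (M : Matrix (Fin m) (Fin n) ℝ) {x : Fin m → ℝ} {y : Fin n → ℝ}
    (hx : x ∈ stdSimplex ℝ (Fin m)) (hy : y ∈ stdSimplex ℝ (Fin n)) :
    |payoff M x y| ≤ absSum M := by
  rw [payoff_eq_sum]
  calc |∑ j, (x ᵥ* M) j * y j| ≤ ∑ j, absSum M * y j := by
        refine (Finset.abs_sum_le_sum_abs _ _).trans (Finset.sum_le_sum fun j _ => ?_)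
        rw [abs_mul, abs_of_nonneg (hy.1 j)]
        exact mul_le_mul_of_nonneg_right (abs_vecMul_le M hx j) (hy.1 j)
    _ = absSum M := by rw [← Finset.mul_sum, hy.2, mul_one]

/-- If action `i` beats the others by `D`, then playing `y` instead of `i` loses at least
`D (1 - yᵢ)`. -/
lemma le_sub_payoff {m n : ℕ} (M : Matrix (Fin m) (Fin n) ℝ) {x : Fin m → ℝ} {y : Fin n → ℝ}
    (hy : y ∈ stdSimplex ℝ (Fin n)) (i : Fin n) {D : ℝ}
    (h : ∀ j, j ≠ i → (x ᵥ* M) j - (x ᵥ* M) i ≤ -D) :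
    D * (1 - y i) ≤ (x ᵥ* M) i - payoff M x y := by
  have h1 : 1 - y i = ∑ j ∈ Finset.univ.erase i, y j := by
    rw [← hy.2, ← Finset.add_sum_erase _ _ (Finset.mem_univ i)]; ring
  rw [sub_payoff M x hy, h1, Finset.mul_sum, ← Finset.add_sum_erase _ _ (Finset.mem_univ i),
    sub_self, zero_mul, zero_add]
  exact Finset.sum_le_sum fun j hj =>
    mul_le_mul_of_nonneg_right (by linarith [h j (Finset.ne_of_mem_erase hj)]) (hy.1 j)

lemma sub_payoff_le {m n : ℕ} (M : Matrix (Fin m) (Fin n) ℝ) {x : Fin m → ℝ} {y : Fin n → ℝ}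
    (hx : x ∈ stdSimplex ℝ (Fin m)) (hy : y ∈ stdSimplex ℝ (Fin n)) (i : Fin n) :
    (x ᵥ* M) i - payoff M x y ≤ 2 * absSum M * (1 - y i) := by
  have h1 : 1 - y i = ∑ j ∈ Finset.univ.erase i, y j := by
    rw [← hy.2, ← Finset.add_sum_erase _ _ (Finset.mem_univ i)]; ring
  rw [sub_payoff M x hy, h1, Finset.mul_sum, ← Finset.add_sum_erase _ _ (Finset.mem_univ i),
    sub_self, zero_mul, zero_add]
  refine Finset.sum_le_sum fun j _ => mul_le_mul_of_nonneg_right ?_ (hy.1 j)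
  have := abs_le.1 (abs_vecMul_le M hx j)
  have := abs_le.1 (abs_vecMul_le M hx i)
  linarith

/-! ### Perturbation of the class matrices -/

lemma abs_sub_le_spread {m n : ℕ} (B : Matrix (Fin m) (Fin n) ℝ) (r : Fin m) (j i : Fin n) :
    |B r j - B r i| ≤ spread B := by
  have h1 := norm_le_pi_norm (fun r : Fin m => B r j - B r i) r
  refine h1.trans ?_
  exact le_ciSup (f := fun p : Fin n × Fin n => ‖fun r : Fin m => B r p.1 - B r p.2‖)
    (Set.finite_range _).bddAbove (j, i)

lemma spread_nonneg {m n : ℕ} (B : Matrix (Fin m) (Fin n) ℝ) : 0 ≤ spread B :=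
  Real.iSup_nonneg fun _ => norm_nonneg _

lemma spread_le {m n : ℕ} {B : Matrix (Fin m) (Fin n) ℝ} {a : ℝ} (ha : 0 ≤ a)
    (h : ∀ r j i, |B r j - B r i| ≤ a) : spread B ≤ a :=
  Real.iSup_le (fun p => (pi_norm_le_iff_of_nonneg ha).2 fun r => h r p.1 p.2) ha

lemma abs_spread_sub_le {m n : ℕ} {B B' : Matrix (Fin m) (Fin n) ℝ} {e : ℝ} (he : 0 ≤ e)
    (h : ∀ r j i, |(B' r j - B' r i) - (B r j - B r i)| ≤ e) :
    |spread B' - spread B| ≤ e := by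
  have h1 : spread B' ≤ spread B + e := by
    refine spread_le (add_nonneg (spread_nonneg B) he) fun r j i => ?_
    have := abs_le.1 (h r j i)
    have := abs_le.1 (abs_sub_le_spread B r j i)
    exact abs_le.2 ⟨by linarith, by linarith⟩
  have h2 : spread B ≤ spread B' + e := by
    refine spread_le (add_nonneg (spread_nonneg B') he) fun r j i => ?_
    have := abs_le.1 (h r j i)
    have := abs_le.1 (abs_sub_le_spread B' r j i)
    exact abs_le.2 ⟨by linarith, by linarith⟩
  exact abs_le.2 ⟨by linarith, by linarith⟩

/-- Normalizing by the spread at most doubles the relative error of the column differences. -/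
lemma abs_classMatrix_sub_le {m n : ℕ} {B B' : Matrix (Fin m) (Fin n) ℝ} {e : ℝ} (he : 0 ≤ e)
    (h : ∀ r j i, |(B' r j - B' r i) - (B r j - B r i)| ≤ e) (hs : 0 < spread B)
    (i : Fin n) (r : Fin m) (j : {j : Fin n // j ≠ i}) :
    |classMatrix B' i r j - classMatrix B i r j| ≤ 2 * e / spread B := by
  have hsp := abs_spread_sub_le he h
  have ha := abs_sub_le_spread B' r j i
  have hd := h r j i
  simp only [classMatrix, Matrix.of_apply]
  set s := spread B
  set s' := spread B'
  set a := B r j - B r i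
  set a' := B' r j - B' r i
  have hq : |a' / s'| ≤ 1 := by
    rw [abs_div, abs_of_nonneg (spread_nonneg B')]
    exact div_le_one_of_le₀ ha (spread_nonneg B')
  have hq' : a' / s' * s' = a' := by
    rcases (spread_nonneg B').eq_or_lt with h0 | h0
    · rw [show s' = 0 from h0.symm] at ha ⊢
      rw [abs_eq_zero.1 (le_antisymm ha (abs_nonneg _))]; simp
    · exact div_mul_cancel₀ _ h0.ne'
  have key : a' / s' - a / s = ((a' - a) - a' / s' * (s' - s)) / s := by
    rw [eq_div_iff hs.ne', sub_mul, div_mul_cancel₀ _ hs.ne', mul_sub, hq']; ring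
  rw [key, abs_div, abs_of_pos hs]
  refine div_le_div_of_nonneg_right ?_ hs.le
  calc |(a' - a) - a' / s' * (s' - s)| ≤ |a' - a| + |a' / s'| * |s' - s| := by
        rw [← abs_mul]; exact abs_sub _ _
    _ ≤ e + 1 * e := by gcongr
    _ = 2 * e := by ring

lemma mem_pessimisticFacet_of_close {m n : ℕ} {B B' : Matrix (Fin m) (Fin n) ℝ} {i : Fin n}
    {d a : ℝ} (h : ∀ r (j : {j : Fin n // j ≠ i}), |classMatrix B' i r j - classMatrix B i r j| ≤ a)
    {x : Fin m → ℝ} (hx : x ∈ pessimisticFacet B i d) : x ∈ pessimisticFacet B' i (d - a) := by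
  refine ⟨hx.1, fun j => ?_⟩
  have h1 : (x ᵥ* classMatrix B' i) j - (x ᵥ* classMatrix B i) j ≤ a := by
    calc (x ᵥ* classMatrix B' i) j - (x ᵥ* classMatrix B i) j
        = ∑ r, x r * (classMatrix B' i r j - classMatrix B i r j) := by
          simp only [mul_sub, Finset.sum_sub_distrib]; rfl
      _ ≤ ∑ r, x r * a := Finset.sum_le_sum fun r _ =>
          mul_le_mul_of_nonneg_left ((le_abs_self _).trans (h r j)) (hx.1.1 r)
      _ = a := by rw [← Finset.sum_mul, hx.1.2, one_mul]
  linarith [hx.2 j]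

lemma vecMul_classMatrix {m n : ℕ} (B : Matrix (Fin m) (Fin n) ℝ) (i : Fin n) (x : Fin m → ℝ)
    (j : {j : Fin n // j ≠ i}) :
    (x ᵥ* classMatrix B i) j = ((x ᵥ* B) j - (x ᵥ* B) i) / spread B := by
  simp only [Matrix.vecMul, dotProduct, classMatrix, Matrix.of_apply, ← Finset.sum_sub_distrib,
    Finset.sum_div]
  exact Finset.sum_congr rfl fun r _ => by ring

lemma vecMul_sub_le_of_mem_pessimisticFacet {m n : ℕ} {B : Matrix (Fin m) (Fin n) ℝ}
    (hs : 0 < spread B) {i : Fin n} {d : ℝ} {x : Fin m → ℝ} (hx : x ∈ pessimisticFacet B i d)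
    (j : Fin n) (hj : j ≠ i) : (x ᵥ* B) j - (x ᵥ* B) i ≤ -(d * spread B) := by
  have h := hx.2 ⟨j, hj⟩
  rw [vecMul_classMatrix, div_le_iff₀ hs] at h
  linarith

lemma mem_pessimisticFacet_zero {m n : ℕ} {B : Matrix (Fin m) (Fin n) ℝ} {i : Fin n}
    {x : Fin m → ℝ} (hx : x ∈ stdSimplex ℝ (Fin m)) (h : ∀ j, (x ᵥ* B) j ≤ (x ᵥ* B) i) :
    x ∈ pessimisticFacet B i 0 := by
  refine ⟨hx, fun j => ?_⟩
  rw [vecMul_classMatrix, neg_zero]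
  exact div_nonpos_of_nonpos_of_nonneg (sub_nonpos.2 (h j)) (spread_nonneg B)

lemma exists_mem_pessimisticFacet_zero {m n : ℕ} (hm : 0 < m) (hn : 0 < n)
    (B : Matrix (Fin m) (Fin n) ℝ) : ∃ i x, x ∈ pessimisticFacet B i 0 := by
  have : Nonempty (Fin n) := ⟨⟨0, hn⟩⟩
  obtain ⟨i, hi⟩ := Finite.exists_max
    ((Pi.single (⟨0, hm⟩ : Fin m) (1 : ℝ) : Fin m → ℝ) ᵥ* B)
  exact ⟨i, _, mem_pessimisticFacet_zero (single_mem_stdSimplex ℝ _) hi⟩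

/-! ### The inducibility gap and the Stackelberg value -/

lemma nonempty_ne_index {n : ℕ} (hn : 2 ≤ n) (i : Fin n) : Nonempty {j : Fin n // j ≠ i} := by
  have : Nontrivial (Fin n) := Fin.nontrivial_iff_two_le.2 hn
  obtain ⟨j, hj⟩ := exists_ne i
  exact ⟨⟨j, hj⟩⟩

lemma spread_pos {m n : ℕ} {B : Matrix (Fin m) (Fin n) ℝ} {i : Fin n}
    (h : inducibilityGap B i ≠ 0) : 0 < spread B := by
  refine (spread_nonneg B).lt_of_ne fun h0 => h ?_
  have : classMatrix B i = 0 := by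
    ext r j
    simp [classMatrix, ← h0]
  simp [inducibilityGap, this]

/-- A nonempty facet with nonzero inducibility gap contains a point whose best response `i` is
strict. -/
lemma exists_mem_pessimisticFacet_pos {m n : ℕ} (hn : 2 ≤ n) {B : Matrix (Fin m) (Fin n) ℝ}
    {i : Fin n} (hgap : inducibilityGap B i ≠ 0) {x : Fin m → ℝ}
    (hx : x ∈ pessimisticFacet B i 0) : ∃ κ > 0, (pessimisticFacet B i κ).Nonempty := by
  have := nonempty_ne_index hn i
  have : Nonempty (stdSimplex ℝ (Fin m)) := ⟨⟨x, hx.1⟩⟩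
  set F : stdSimplex ℝ (Fin m) → ℝ := fun x => ⨆ j : {j : Fin n // j ≠ i},
    ((x : Fin m → ℝ) ᵥ* classMatrix B i) j with hF
  have hle : inducibilityGap B i ≤ 0 := by
    by_cases hb : BddBelow (Set.range F)
    · exact (ciInf_le hb ⟨x, hx.1⟩).trans (ciSup_le fun j => (hx.2 j).trans_eq neg_zero)
    -- an infimum over a set unbounded below is `0` by convention
    · exact (Real.iInf_of_not_bddBelow hb).le
  have hlt : ⨅ x, F x < 0 := hle.lt_of_ne hgap
  obtain ⟨x₀, hx₀⟩ := exists_lt_of_ciInf_lt hlt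
  refine ⟨-F x₀, by linarith, x₀, x₀.2, fun j => ?_⟩
  rw [neg_neg]
  exact le_ciSup (f := fun j => ((x₀ : Fin m → ℝ) ᵥ* classMatrix B i) j)
    (Set.finite_range _).bddAbove j

lemma pessimisticFacet_anti {m n : ℕ} (B : Matrix (Fin m) (Fin n) ℝ) (i : Fin n) {d d' : ℝ}
    (h : d ≤ d') : pessimisticFacet B i d' ⊆ pessimisticFacet B i d :=
  fun _ hx => ⟨hx.1, fun j => (hx.2 j).trans (neg_le_neg h)⟩

lemma exists_uniform_gap {m n : ℕ} (hn : 2 ≤ n) {B : Matrix (Fin m) (Fin n) ℝ}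
    (hgap : ∀ i, inducibilityGap B i ≠ 0) :
    ∃ κ > 0, ∀ i x, x ∈ pessimisticFacet B i 0 → (pessimisticFacet B i κ).Nonempty := by
  have h : ∀ i, ∃ κ > 0, ∀ x, x ∈ pessimisticFacet B i 0 → (pessimisticFacet B i κ).Nonempty := by
    intro i
    by_cases hx : ∃ x, x ∈ pessimisticFacet B i 0
    · obtain ⟨x, hx⟩ := hx
      obtain ⟨κ, h1, h2⟩ := exists_mem_pessimisticFacet_pos hn (hgap i) hx
      exact ⟨κ, h1, fun _ _ => h2⟩
    · exact ⟨1, one_pos, fun x h => (hx ⟨x, h⟩).elim⟩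
  choose κ hκ h using h
  have : Nonempty (Fin n) := ⟨⟨0, by omega⟩⟩
  obtain ⟨i₀, hi₀⟩ := Finite.exists_min κ
  exact ⟨κ i₀, hκ i₀, fun i x hx => (h i x hx).mono (pessimisticFacet_anti B i (hi₀ i))⟩

/-- Moving a fraction `l` of the way towards a strict point enters the pessimistic facet of margin
`l κ`, at a loss of payoff proportional to `l`. -/
lemma exists_mem_pessimisticFacet_near {m n : ℕ} {B : Matrix (Fin m) (Fin n) ℝ} {i : Fin n}
    {κ l : ℝ} (hne : (pessimisticFacet B i κ).Nonempty) (hl₀ : 0 ≤ l) (hl₁ : l ≤ 1)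
    {x : Fin m → ℝ} (hx : x ∈ pessimisticFacet B i 0) (A : Matrix (Fin m) (Fin n) ℝ) :
    ∃ x' ∈ pessimisticFacet B i (l * κ), (x ᵥ* A) i - 2 * absSum A * l ≤ (x' ᵥ* A) i := by
  obtain ⟨x₀, hx₀⟩ := hne
  refine ⟨(1 - l) • x + l • x₀, ⟨convex_stdSimplex ℝ _ hx.1 hx₀.1 (by linarith) hl₀ (by ring),
    fun j => ?_⟩, ?_⟩
  · rw [Matrix.add_vecMul, Matrix.smul_vecMul, Matrix.smul_vecMul]
    simp only [Pi.add_apply, Pi.smul_apply, smul_eq_mul]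
    have h1 := mul_le_mul_of_nonneg_left (hx.2 j) (sub_nonneg.2 hl₁)
    have h2 := mul_le_mul_of_nonneg_left (hx₀.2 j) hl₀
    linarith
  · rw [Matrix.add_vecMul, Matrix.smul_vecMul, Matrix.smul_vecMul]
    simp only [Pi.add_apply, Pi.smul_apply, smul_eq_mul]
    have h1 := abs_le.1 (abs_vecMul_le A hx.1 i)
    have h2 := abs_le.1 (abs_vecMul_le A hx₀.1 i)
    nlinarith

/-- Every mixed best response is a mixture of pure ones. -/
lemma payoff_le_of_mem_bestResponses {m n : ℕ} {A B : Matrix (Fin m) (Fin n) ℝ} {v : ℝ}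
    (h : ∀ i, ∀ x ∈ pessimisticFacet B i 0, (x ᵥ* A) i ≤ v) {x : Fin m → ℝ} {y : Fin n → ℝ}
    (hx : x ∈ stdSimplex ℝ (Fin m)) (hy : y ∈ bestResponses B x) : payoff A x y ≤ v := by
  have hle : ∀ j, (x ᵥ* B) j ≤ payoff B x y := fun j => by
    rw [← payoff_single]; exact hy.2 _ (single_mem_stdSimplex ℝ j)
  have hsum : ∑ j, (payoff B x y - (x ᵥ* B) j) * y j = 0 := by
    rw [← sub_payoff B x hy.1, sub_self]
  rw [Finset.sum_eq_zero_iff_of_nonneg fun j _ =>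
    mul_nonneg (sub_nonneg.2 (hle j)) (hy.1.1 j)] at hsum
  rw [← sub_nonneg, sub_payoff A x hy.1]
  refine Finset.sum_nonneg fun j _ => ?_
  rcases mul_eq_zero.1 (hsum j (Finset.mem_univ j)) with h0 | h0
  · refine mul_nonneg (sub_nonneg.2 (h j x (mem_pessimisticFacet_zero hx fun l => ?_))) (hy.1.1 j)
    linarith [hle l]
  · rw [h0, mul_zero]

lemma stackelbergValue_le {m n : ℕ} (hm : 0 < m) (hn : 0 < n) {A B : Matrix (Fin m) (Fin n) ℝ}
    {v : ℝ} (h : ∀ i, ∀ x ∈ pessimisticFacet B i 0, (x ᵥ* A) i ≤ v) :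
    stackelbergValue A B ≤ v := by
  refine csSup_le ?_ ?_
  · have : Nonempty (Fin n) := ⟨⟨0, hn⟩⟩
    obtain ⟨i, hi⟩ := Finite.exists_max
      ((Pi.single (⟨0, hm⟩ : Fin m) (1 : ℝ) : Fin m → ℝ) ᵥ* B)
    refine ⟨_, Pi.single ⟨0, hm⟩ 1, single_mem_stdSimplex ℝ _, Pi.single i 1,
      ⟨single_mem_stdSimplex ℝ _, fun y' hy' => ?_⟩, rfl⟩
    rw [payoff_single]
    exact payoff_le_of_forall hy' hi
  · rintro _ ⟨x, hx, y, hy, rfl⟩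
    exact payoff_le_of_mem_bestResponses h hx hy

lemma stackelbergValue_le_absSum {m n : ℕ} (hm : 0 < m) (hn : 0 < n)
    (A B : Matrix (Fin m) (Fin n) ℝ) : stackelbergValue A B ≤ absSum A :=
  stackelbergValue_le hm hn fun i _ hx => (le_abs_self _).trans (abs_vecMul_le A hx.1 i)

/-- A commitment computed from an estimate `B'` whose class matrices are `a`-close to the true
ones: it exists, induces its intended response `i` with margin `d - a`, and loses at most
`2 ‖A‖ (d + a) / κ` against the Stackelberg value. -/
lemma SolvesPessimistic.mem_and_value_le {m n : ℕ} (hm : 0 < m) (hn : 0 < n)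
    {A B B' : Matrix (Fin m) (Fin n) ℝ} {κ d a : ℝ} (hκ : 0 < κ)
    (hne : ∀ i x, x ∈ pessimisticFacet B i 0 → (pessimisticFacet B i κ).Nonempty)
    (hda : 0 ≤ d + a) (hdκ : d + a ≤ κ)
    (hclose : ∀ i r (j : {j : Fin n // j ≠ i}),
      |classMatrix B' i r j - classMatrix B i r j| ≤ a)
    {x : Fin m → ℝ}
    (hx : (∃ i, (pessimisticFacet B' i d).Nonempty) → SolvesPessimistic A B' d x) :
    ∃ i, x ∈ pessimisticFacet B i (d - a) ∧
      stackelbergValue A B ≤ (x ᵥ* A) i + 2 * absSum A * ((d + a) / κ) := by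
  have near : ∀ i, ∀ z ∈ pessimisticFacet B i 0, ∃ z' ∈ pessimisticFacet B' i d,
      (z ᵥ* A) i - 2 * absSum A * ((d + a) / κ) ≤ (z' ᵥ* A) i := by
    intro i z hz
    obtain ⟨z', hz', hle⟩ := exists_mem_pessimisticFacet_near (hne i z hz)
      (div_nonneg hda hκ.le) (div_le_one_of_le₀ hdκ hκ.le) hz A
    rw [div_mul_cancel₀ _ hκ.ne'] at hz'
    have := mem_pessimisticFacet_of_close (hclose i) hz'
    rw [add_sub_cancel_right] at this
    exact ⟨z', this, hle⟩
  obtain ⟨i₀, x₀, hx₀⟩ := exists_mem_pessimisticFacet_zero hm hn B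
  obtain ⟨z₀, hz₀, -⟩ := near i₀ x₀ hx₀
  obtain ⟨i, hi, hmax⟩ := hx ⟨i₀, z₀, hz₀⟩
  refine ⟨i, mem_pessimisticFacet_of_close (fun r j => ?_) hi, stackelbergValue_le hm hn ?_⟩
  · rw [abs_sub_comm]; exact hclose i r j
  · intro l z hz
    obtain ⟨z', hz', hle⟩ := near l z hz
    linarith [hmax l z' hz']

/-! ### Mirror ascent steps -/

/-- The tangent of a convex function lies below its graph. -/
lemma add_fderiv_le_of_convexOn {E : Type*} [NormedAddCommGroup E] [NormedSpace ℝ E] {s : Set E}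
    {f : E → ℝ} (hf : ConvexOn ℝ s f) {z w : E} (hz : z ∈ s) (hw : w ∈ s)
    (hd : DifferentiableAt ℝ f z) : f z + fderiv ℝ f z (w - z) ≤ f w := by
  have hconv : ConvexOn ℝ (Set.Icc 0 1) (f ∘ (AffineMap.lineMap z w : ℝ →ᵃ[ℝ] E)) := by
    refine (hf.comp_affineMap _).subset (fun t ht => ?_) (convex_Icc 0 1)
    exact hf.1.segment_subset hz hw (by
      rw [segment_eq_image_lineMap]; exact ⟨t, ht, rfl⟩)
  have hder : HasDerivAt (f ∘ (AffineMap.lineMap z w : ℝ →ᵃ[ℝ] E)) (fderiv ℝ f z (w - z)) 0 := by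
    have h1 : HasFDerivAt f (fderiv ℝ f z) ((AffineMap.lineMap z w : ℝ →ᵃ[ℝ] E) 0) := by
      simpa using hd.hasFDerivAt
    exact h1.comp_hasDerivAt 0 AffineMap.hasDerivAt_lineMap
  have := hconv.le_slope_of_hasDerivAt (by simp) (by simp) one_pos hder
  simp only [slope, sub_zero, inv_one, one_smul, vsub_eq_sub, Function.comp_apply,
    AffineMap.lineMap_apply_one, AffineMap.lineMap_apply_zero] at this
  linarith

lemma bregman_sub_bregman {n : ℕ} (ψ : (Fin n → ℝ) → ℝ) (p : Fin n → ℝ) (w z : Fin n → ℝ) :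
    bregman ψ w p - bregman ψ z p = ψ w - ψ z - fderiv ℝ ψ p (w - z) := by
  simp only [bregman, map_sub]; ring

lemma combination_mem_openSimplex {n : ℕ} {p q : Fin n → ℝ} (hp : p ∈ openSimplex n)
    (hq : q ∈ stdSimplex ℝ (Fin n)) {s : ℝ} (hs₀ : 0 < s) (hs₁ : s ≤ 1) :
    (1 - s) • q + s • p ∈ openSimplex n := by
  refine ⟨convex_stdSimplex ℝ _ hq hp.1 (by linarith) hs₀.le (by ring), fun i => ?_⟩
  have h1 := mul_nonneg (sub_nonneg.2 hs₁) (hq.1 i)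
  have h2 := mul_pos hs₀ (hp.2 i)
  simp only [Pi.add_apply, Pi.smul_apply, smul_eq_mul]
  linarith

/-- An upper bound on the derivative of `ψ` at `z` in the direction `z - p` bounds the whole
gradient at `z`, because the tangent at `z` lies below `ψ`, which is finite around `p`. -/
lemma IsRegularizer.exists_bound_gradient {n : ℕ} {ψ : (Fin n → ℝ) → ℝ} {dom : Set (Fin n → ℝ)}
    (hψ : IsRegularizer ψ dom) {p : Fin n → ℝ} (hp : p ∈ openSimplex n) (a : ℝ) :
    ∃ K, ∀ z ∈ openSimplex n, fderiv ℝ ψ z (z - p) ≤ a → ∀ j,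
      |fderiv ℝ ψ z (Pi.single j 1)| ≤ K := by
  obtain ⟨r, hr, hball⟩ := Metric.isOpen_iff.1 isOpen_interior p (hψ.subset_interior hp)
  have hball' : ∀ (j : Fin n) (e : ℝ), |e| = r / 2 → p + e • Pi.single j (1 : ℝ) ∈ dom := by
    intro j e he
    refine interior_subset (hball ?_)
    rw [Metric.mem_ball, dist_self_add_left, norm_smul, Real.norm_eq_abs, he]
    have : ‖(Pi.single j 1 : Fin n → ℝ)‖ ≤ 1 :=
      (pi_norm_le_iff_of_nonneg zero_le_one).2 fun l => by
        rcases eq_or_ne l j with rfl | h <;> simp [*]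
    nlinarith
  set U : ℝ := ∑ j : Fin n, (|ψ (p + (r / 2) • Pi.single j (1 : ℝ))|
    + |ψ (p + (-(r / 2)) • Pi.single j (1 : ℝ))|) with hU
  set W : ℝ := ∑ j : Fin n, |fderiv ℝ ψ p (Pi.single j 1)| with hW
  refine ⟨(U - ψ p + W + a) / (r / 2), fun z hz hza j => ?_⟩
  have hzd : z ∈ dom := interior_subset (hψ.subset_interior hz)
  have hpd : p ∈ dom := interior_subset (hψ.subset_interior hp)
  -- the tangent at `p` bounds `ψ z` from below
  have hlow : ψ p - W ≤ ψ z := by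
    have h1 := add_fderiv_le_of_convexOn hψ.convexOn hpd hzd (hψ.differentiableAt p hp)
    have h2 : -W ≤ fderiv ℝ ψ p (z - p) := by
      have h3 : fderiv ℝ ψ p (z - p) = ∑ j, (z j - p j) * fderiv ℝ ψ p (Pi.single j 1) := by
        conv_lhs => rw [pi_eq_sum_univ' (z - p)]
        simp [map_sum]
      rw [h3, hW, ← Finset.sum_neg_distrib]
      refine Finset.sum_le_sum fun l _ => ?_
      have hz1 := le_one_of_mem_stdSimplex hz.1 l
      have hp1 := le_one_of_mem_stdSimplex hp.1 l
      have hab : |z l - p l| ≤ 1 :=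
        abs_le.2 ⟨by linarith [hz.1.1 l], by linarith [hp.1.1 l]⟩
      have := mul_le_of_le_one_left (abs_nonneg (fderiv ℝ ψ p (Pi.single l 1))) hab
      rw [← abs_mul] at this
      exact neg_le_of_abs_le this
    linarith
  have hup : ∀ e : ℝ, |e| = r / 2 → ψ (p + e • Pi.single j (1 : ℝ)) ≤ U →
      e * fderiv ℝ ψ z (Pi.single j 1) ≤ U - ψ p + W + a := by
    intro e he hUe
    have h1 := add_fderiv_le_of_convexOn hψ.convexOn hzd (hball' j e he) (hψ.differentiableAt z hz)
    have h2 : fderiv ℝ ψ z (p + e • Pi.single j (1 : ℝ) - z)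
        = e * fderiv ℝ ψ z (Pi.single j 1) - fderiv ℝ ψ z (z - p) := by
      rw [show p + e • Pi.single j (1 : ℝ) - z = e • Pi.single j (1 : ℝ) - (z - p) by abel,
        map_sub, map_smul, smul_eq_mul]
    linarith
  have hUj := Finset.single_le_sum (f := fun j : Fin n =>
    |ψ (p + (r / 2) • Pi.single j (1 : ℝ))| + |ψ (p + (-(r / 2)) • Pi.single j (1 : ℝ))|)
    (fun _ _ => by positivity) (Finset.mem_univ j)
  simp only [← hU] at hUj
  have h1 := hup (r / 2) (abs_of_pos (by positivity)) (by
    linarith [le_abs_self (ψ (p + (r / 2) • Pi.single j (1 : ℝ))),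
      abs_nonneg (ψ (p + (-(r / 2)) • Pi.single j (1 : ℝ)))])
  have h2 := hup (-(r / 2)) (by rw [abs_neg]; exact abs_of_pos (by positivity)) (by
    linarith [le_abs_self (ψ (p + (-(r / 2)) • Pi.single j (1 : ℝ))),
      abs_nonneg (ψ (p + (r / 2) • Pi.single j (1 : ℝ)))])
  rw [le_div_iff₀ (by positivity), ← abs_of_pos (show 0 < r / 2 by positivity), ← abs_mul]
  exact abs_le.2 ⟨by linarith, by linarith⟩

/-- The iterate of a mirror ascent step stays in the relative interior: at a boundary minimizer `q`
the derivatives along the segment from `q` to `p` would be bounded, hence so would the gradients,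
which contradicts the blow-up. -/
lemma IsRegularizer.argmin_mem_openSimplex {n : ℕ} {ψ : (Fin n → ℝ) → ℝ}
    {dom : Set (Fin n → ℝ)} (hψ : IsRegularizer ψ dom) {p q b : Fin n → ℝ} {η : ℝ} (hη : 0 < η)
    (hp : p ∈ openSimplex n) (hq : q ∈ stdSimplex ℝ (Fin n) ∩ dom)
    (hmin : IsMinOn (fun z => η * bregman ψ z p - b ⬝ᵥ z) (stdSimplex ℝ (Fin n) ∩ dom) q) :
    q ∈ openSimplex n := by
  by_contra hnot
  obtain ⟨i, hi⟩ : ∃ i, q i = 0 := by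
    by_contra! h
    exact hnot ⟨hq.1, fun i => (hq.1.1 i).lt_of_ne (h i).symm⟩
  -- optimality of `q` bounds the derivative towards `p` along the segment from `q` to `p`
  set a : ℝ := fderiv ℝ ψ p (q - p) + (b ⬝ᵥ (q - p)) / η with ha
  obtain ⟨K, hK⟩ := hψ.exists_bound_gradient hp |a|
  obtain ⟨ρ, hρ, hblow⟩ := hψ.blowup p hp
    (|K| + ∑ j, |fderiv ℝ ψ p (Pi.single j 1)| + 1)
  set s : ℝ := min 1 (ρ / 2) with hs
  have hs₀ : 0 < s := by positivity
  have hs₁ : s ≤ 1 := min_le_left _ _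
  -- for this `s`, coordinate `i` of `z` is below `ρ`, where the gradient is large
  set z : Fin n → ℝ := (1 - s) • q + s • p with hz
  have hzo : z ∈ openSimplex n := combination_mem_openSimplex hp hq.1 hs₀ hs₁
  have hzd : z ∈ dom := interior_subset (hψ.subset_interior hzo)
  have hqz : q - z = s • (q - p) := by rw [hz]; module
  have hzp : z - p = (1 - s) • (q - p) := by rw [hz]; module
  have hder : fderiv ℝ ψ z (q - p) ≤ a := by
    have h1 := add_fderiv_le_of_convexOn hψ.convexOn hzd hq.2 (hψ.differentiableAt z hzo)
    have h2 : η * bregman ψ q p - b ⬝ᵥ q ≤ η * bregman ψ z p - b ⬝ᵥ z := hmin ⟨hzo.1, hzd⟩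
    have h3 := bregman_sub_bregman ψ p q z
    have h4 : b ⬝ᵥ q - b ⬝ᵥ z = s * (b ⬝ᵥ (q - p)) := by
      rw [← dotProduct_sub, hqz, dotProduct_smul, smul_eq_mul]
    rw [hqz, map_smul, smul_eq_mul] at h1 h3
    have h5 : η * (s * fderiv ℝ ψ z (q - p) - s * fderiv ℝ ψ p (q - p))
        ≤ s * (b ⬝ᵥ (q - p)) := by
      have h6 := mul_le_mul_of_nonneg_left
        (show s * fderiv ℝ ψ z (q - p) - s * fderiv ℝ ψ p (q - p)
          ≤ bregman ψ q p - bregman ψ z p by linarith) hη.le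
      linarith
    have h7 : s * (η * (fderiv ℝ ψ z (q - p) - fderiv ℝ ψ p (q - p)))
        ≤ s * (b ⬝ᵥ (q - p)) := by linarith
    have h8 := le_of_mul_le_mul_left h7 hs₀
    have h9 : fderiv ℝ ψ z (q - p) - fderiv ℝ ψ p (q - p) ≤ (b ⬝ᵥ (q - p)) / η := by
      rw [le_div_iff₀ hη]; linarith
    rw [ha]; linarith
  have hder' : fderiv ℝ ψ z (z - p) ≤ |a| := by
    rw [hzp, map_smul, smul_eq_mul]
    calc (1 - s) * fderiv ℝ ψ z (q - p) ≤ (1 - s) * |a| :=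
          mul_le_mul_of_nonneg_left (hder.trans (le_abs_self a)) (by linarith)
      _ ≤ |a| := mul_le_of_le_one_left (abs_nonneg a) (by linarith)
  have hbound := hK z hzo hder'
  have hlarge := hblow z hzo ⟨i, by
    have hp1 := le_one_of_mem_stdSimplex hp.1 i
    have h1 : z i = s * p i := by simp [hz, hi]
    have h2 : s ≤ ρ / 2 := min_le_right _ _
    rw [h1]
    nlinarith⟩
  have hsmall : ‖gradBregman ψ z p‖ ≤ |K| + ∑ j, |fderiv ℝ ψ p (Pi.single j 1)| := by
    refine (pi_norm_le_iff_of_nonneg (by positivity)).2 fun j => ?_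
    rw [gradBregman_eq ψ z p (hψ.differentiableAt z hzo), Real.norm_eq_abs]
    refine (abs_sub _ _).trans (add_le_add ((hbound j).trans (le_abs_self K)) ?_)
    exact Finset.single_le_sum (f := fun j => |fderiv ℝ ψ p (Pi.single j 1)|)
      (fun _ _ => abs_nonneg _) (Finset.mem_univ j)
  linarith

/-- First order condition of a mirror ascent step: up to a multiple of the all-ones vector, the
scaled gradient of the divergence reveals the vector `b`. -/
lemma IsRegularizer.gradBregman_sub_eq {n : ℕ} {ψ : (Fin n → ℝ) → ℝ}
    {dom : Set (Fin n → ℝ)} (hψ : IsRegularizer ψ dom) {p q b : Fin n → ℝ} {η : ℝ}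
    (hq : q ∈ openSimplex n)
    (hmin : IsMinOn (fun z => η * bregman ψ z p - b ⬝ᵥ z) (stdSimplex ℝ (Fin n) ∩ dom) q)
    (i j : Fin n) :
    η * gradBregman ψ q p i - b i = η * gradBregman ψ q p j - b j := by
  rcases eq_or_ne i j with rfl | hij
  · rfl
  set v : Fin n → ℝ := Pi.single i 1 - Pi.single j 1 with hv
  set F : (Fin n → ℝ) → ℝ := fun z => η * bregman ψ z p - b ⬝ᵥ z with hF
  have hlocal : IsLocalMin (fun e : ℝ => F (q + e • v)) 0 := by
    have hev : ∀ᶠ e : ℝ in 𝓝 0, ∀ l, 0 < (q + e • v) l := by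
      refine eventually_all.2 fun l => ?_
      have : Tendsto (fun e : ℝ => (q + e • v) l) (𝓝 0) (𝓝 ((q + (0 : ℝ) • v) l)) := by
        simp only [Pi.add_apply, Pi.smul_apply, smul_eq_mul]
        exact Continuous.tendsto (by fun_prop) 0
      exact this.eventually_const_lt (by simpa using hq.2 l)
    filter_upwards [hev] with e he
    have hmem : q + e • v ∈ openSimplex n := by
      refine ⟨⟨fun l => (he l).le, ?_⟩, he⟩
      simp [hv, Finset.sum_add_distrib, hq.1.2, ← Finset.mul_sum]
    have := hmin ⟨hmem.1, interior_subset (hψ.subset_interior hmem)⟩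
    simpa using this
  have hfd : HasFDerivAt (fun z => bregman ψ z p) (fderiv ℝ ψ q - fderiv ℝ ψ p) q := by
    have h2 := ((hψ.differentiableAt q hq).hasFDerivAt.sub_const (ψ p)).sub
      ((fderiv ℝ ψ p).hasFDerivAt.comp q ((hasFDerivAt_id q).sub_const p))
    exact h2
  have hline : HasDerivAt (fun e : ℝ => q + e • v) v 0 := by
    have := ((hasDerivAt_id (0 : ℝ)).smul_const v).const_add q
    rwa [one_smul] at this
  have hder : HasDerivAt (fun e : ℝ => F (q + e • v))
      (η * ((fderiv ℝ ψ q - fderiv ℝ ψ p) v) - b ⬝ᵥ v) 0 := by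
    have h1 : HasDerivAt (fun e : ℝ => bregman ψ (q + e • v) p)
        ((fderiv ℝ ψ q - fderiv ℝ ψ p) v) 0 := by
      have hfd' : HasFDerivAt (fun z => bregman ψ z p) (fderiv ℝ ψ q - fderiv ℝ ψ p)
          (q + (0 : ℝ) • v) := by simpa using hfd
      exact hfd'.comp_hasDerivAt (0 : ℝ) hline
    have h2 : HasDerivAt (fun e : ℝ => b ⬝ᵥ (q + e • v)) (b ⬝ᵥ v) 0 := by
      simp only [dotProduct_add, dotProduct_smul, smul_eq_mul]
      simpa using ((hasDerivAt_id (0 : ℝ)).mul_const (b ⬝ᵥ v)).const_add (b ⬝ᵥ q)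
    exact (h1.const_mul η).sub h2
  have h0 := hlocal.hasDerivAt_eq_zero hder
  have hd := hψ.differentiableAt q hq
  rw [gradBregman_eq ψ q p hd, gradBregman_eq ψ q p hd]
  simp only [hv, _root_.sub_apply, map_sub, dotProduct_sub, dotProduct_single,
    mul_one] at h0
  linarith

lemma IsPlay.mem_openSimplex {m n : ℕ} {Ω : Type*} [MeasurableSpace Ω]
    {B : Matrix (Fin m) (Fin n) ℝ} {learner : MirrorAscent n} {ξ : ℕ → Ω → Fin n → ℝ}
    {alg : OptimizerAlgorithm m n} {x : ℕ → Ω → Fin m → ℝ} {y : ℕ → Ω → Fin n → ℝ}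
    (h : IsPlay B learner ξ alg x y) (t : ℕ) (ω : Ω) : y t ω ∈ openSimplex n := by
  induction t with
  | zero => rw [h.init]; exact learner.y₁_mem
  | succ t ih =>
    exact learner.isRegularizer.argmin_mem_openSimplex (learner.η_pos t) ih (h.mem t ω)
      (h.update t ω)

lemma single_vecMul_apply {m n : ℕ} (B : Matrix (Fin m) (Fin n) ℝ) (r : Fin m) (j : Fin n) :
    ((Pi.single r 1 : Fin m → ℝ) ᵥ* B) j = B r j := by
  simp

/-- Against the exploring optimizer, the estimate recovers the differences of the columns of `B`
up to the averaged noise. -/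
lemma IsPlay.estimate_sub {m n : ℕ} {Ω : Type*} [MeasurableSpace Ω]
    {B : Matrix (Fin m) (Fin n) ℝ} {learner : MirrorAscent n} {ξ : ℕ → Ω → Fin n → ℝ} {k : ℕ}
    (hk : 0 < k) {alg : OptimizerAlgorithm m n} {x : ℕ → Ω → Fin m → ℝ} {y : ℕ → Ω → Fin n → ℝ}
    (h : IsPlay B learner ξ alg x y) (ω : Ω)
    (hx : ∀ (r : Fin m) (s : ℕ), s < k → x (r * (k + 1) + s) ω = Pi.single r 1)
    (r : Fin m) (i j : Fin n) :
    estimate m learner.ψ learner.η k (fun t => y t ω) r j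
        - estimate m learner.ψ learner.η k (fun t => y t ω) r i
      = (B r j - B r i)
        + ((∑ s ∈ Finset.range k, ξ (r * (k + 1) + s) ω j)
          - ∑ s ∈ Finset.range k, ξ (r * (k + 1) + s) ω i) / k := by
  have hstep : ∀ s ∈ Finset.range k,
      learner.η (r * (k + 1) + s) * gradBregman learner.ψ (y (r * (k + 1) + s + 1) ω)
          (y (r * (k + 1) + s) ω) j
        - learner.η (r * (k + 1) + s) * gradBregman learner.ψ (y (r * (k + 1) + s + 1) ω)
          (y (r * (k + 1) + s) ω) i
      = (B r j - B r i) + (ξ (r * (k + 1) + s) ω j - ξ (r * (k + 1) + s) ω i) := by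
    intro s hs
    have h1 := learner.isRegularizer.gradBregman_sub_eq (h.mem_openSimplex _ ω)
      (h.update (r * (k + 1) + s) ω) j i
    rw [hx r s (Finset.mem_range.1 hs)] at h1
    simp only [Pi.add_apply, single_vecMul_apply] at h1
    linarith
  have hk' : (k : ℝ) ≠ 0 := by positivity
  simp only [estimate, Matrix.of_apply]
  rw [← mul_sub, ← Finset.sum_sub_distrib, Finset.sum_congr rfl hstep, Finset.sum_add_distrib,
    Finset.sum_const, Finset.card_range, nsmul_eq_mul, Finset.sum_sub_distrib]
  field_simp

/-! ### Concentration of the exploration noise -/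

/-- The event that in each of the `m` exploration blocks, each coordinate of the noise summed over
the first `k` rounds is at most `a` in absolute value. -/
def noiseEvent {n : ℕ} {Ω : Type*} (m : ℕ) (ξ : ℕ → Ω → Fin n → ℝ) (k : ℕ) (a : ℝ) : Set Ω :=
  {ω | ∀ (r : Fin m) (j : Fin n), |∑ s ∈ Finset.range k, ξ (r * (k + 1) + s) ω j| ≤ a}

lemma measurableSet_noiseEvent {n : ℕ} {Ω : Type*} (m : ℕ) (ξ : ℕ → Ω → Fin n → ℝ) (k : ℕ)
    (a : ℝ) :
    MeasurableSet[⨆ t : Fin (m * (k + 1)), MeasurableSpace.comap (ξ t) inferInstance]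
      (noiseEvent m ξ k a) := by
  have hmeas : ∀ (t : Fin (m * (k + 1))) (j : Fin n),
      Measurable[⨆ t : Fin (m * (k + 1)), MeasurableSpace.comap (ξ t) inferInstance]
        fun ω => ξ t ω j := fun t j =>
    (measurable_pi_apply j).comp ((comap_measurable (ξ t)).mono
      (le_iSup (fun t : Fin (m * (k + 1)) =>
        MeasurableSpace.comap (ξ t) (inferInstance : MeasurableSpace (Fin n → ℝ))) t) le_rfl)
  let _ : MeasurableSpace Ω :=
    ⨆ t : Fin (m * (k + 1)), MeasurableSpace.comap (ξ t) inferInstance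
  simp only [noiseEvent, Set.ofPred_forall]
  refine MeasurableSet.iInter fun r => MeasurableSet.iInter fun j => ?_
  have hsum : Measurable fun ω => ∑ s ∈ Finset.range k, ξ (r * (k + 1) + s) ω j := by
    refine Finset.measurable_sum _ fun s hs => ?_
    have hs' := Finset.mem_range.1 hs
    have hi : ((r : ℕ) + 1) * (k + 1) ≤ m * (k + 1) := Nat.mul_le_mul_right _ r.2
    have he : ((r : ℕ) + 1) * (k + 1) = (r : ℕ) * (k + 1) + (k + 1) := by ring
    exact hmeas ⟨r * (k + 1) + s, by omega⟩ j
  exact measurableSet_le hsum.abs measurable_const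

lemma iSup_comap_le {n N : ℕ} {Ω : Type*} [mΩ : MeasurableSpace Ω] {ξ : ℕ → Ω → Fin n → ℝ}
    (hξ : ∀ t, Measurable (ξ t)) :
    (⨆ t : Fin N, MeasurableSpace.comap (ξ t) inferInstance) ≤ mΩ :=
  iSup_le fun t => (hξ t).comap_le

lemma IsSubGaussianNoise.measureReal_abs_sum_gt_le {n : ℕ} {Ω : Type*} [MeasurableSpace Ω]
    {μ : Measure Ω} [IsProbabilityMeasure μ] {ξ : ℕ → Ω → Fin n → ℝ} {R : ℝ}
    (h : IsSubGaussianNoise μ ξ R) (t₀ k : ℕ) (j : Fin n) {a : ℝ} (ha : 0 ≤ a) :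
    μ.real {ω | a < |∑ s ∈ Finset.range k, ξ (t₀ + s) ω j|}
      ≤ 2 * Real.exp (-a ^ 2 / (2 * k * R ^ 2)) := by
  have hinj : Function.Injective fun s : ℕ => (t₀ + s, j) := fun s s' hs => by simpa using hs
  have hindep := h.indep.precomp hinj
  have hneg : iIndepFun (fun (s : ℕ) ω => -ξ (t₀ + s) ω j) μ :=
    hindep.comp (fun _ => Neg.neg) fun _ => measurable_neg
  have h1 := HasSubgaussianMGF.measure_sum_range_ge_le_of_iIndepFun hindep
    (n := k) (c := ⟨R ^ 2, sq_nonneg R⟩) (fun s _ => h.subgaussian (t₀ + s, j)) ha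
  have h2 := HasSubgaussianMGF.measure_sum_range_ge_le_of_iIndepFun hneg
    (n := k) (c := ⟨R ^ 2, sq_nonneg R⟩) (fun s _ => (h.subgaussian (t₀ + s, j)).neg) ha
  have hsub : {ω | a < |∑ s ∈ Finset.range k, ξ (t₀ + s) ω j|}
      ⊆ {ω | a ≤ ∑ s ∈ Finset.range k, ξ (t₀ + s) ω j}
        ∪ {ω | a ≤ ∑ s ∈ Finset.range k, -ξ (t₀ + s) ω j} := by
    intro ω hω
    rw [Set.mem_ofPred_eq, lt_abs] at hω
    rcases hω with hω | hω
    · exact Or.inl hω.le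
    · refine Or.inr ?_
      simp only [Set.mem_ofPred_eq, Finset.sum_neg_distrib]
      exact hω.le
  calc _ ≤ _ := measureReal_mono hsub
    _ ≤ _ := measureReal_union_le _ _
    _ ≤ Real.exp (-a ^ 2 / (2 * k * R ^ 2)) + Real.exp (-a ^ 2 / (2 * k * R ^ 2)) :=
        add_le_add h1 h2
    _ = _ := by ring

lemma IsSubGaussianNoise.le_measureReal_noiseEvent {n : ℕ} {Ω : Type*} [MeasurableSpace Ω]
    {μ : Measure Ω} [IsProbabilityMeasure μ] {ξ : ℕ → Ω → Fin n → ℝ} {R : ℝ}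
    (h : IsSubGaussianNoise μ ξ R) (m k : ℕ) {a : ℝ} (ha : 0 ≤ a) :
    1 - 2 * m * n * Real.exp (-a ^ 2 / (2 * k * R ^ 2)) ≤ μ.real (noiseEvent m ξ k a) := by
  have hmeas : MeasurableSet (noiseEvent m ξ k a) :=
    iSup_comap_le h.measurable _ (measurableSet_noiseEvent m ξ k a)
  have hcompl : (noiseEvent m ξ k a)ᶜ
      = ⋃ p : Fin m × Fin n, {ω | a < |∑ s ∈ Finset.range k, ξ (p.1 * (k + 1) + s) ω p.2|} := by
    ext ω
    simp [noiseEvent]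
  have hle : μ.real (noiseEvent m ξ k a)ᶜ
      ≤ 2 * m * n * Real.exp (-a ^ 2 / (2 * k * R ^ 2)) := by
    rw [hcompl]
    calc _ ≤ ∑ p : Fin m × Fin n,
          μ.real {ω | a < |∑ s ∈ Finset.range k, ξ (p.1 * (k + 1) + s) ω p.2|} :=
          measureReal_iUnion_fintype_le _
      _ ≤ ∑ _p : Fin m × Fin n, 2 * Real.exp (-a ^ 2 / (2 * k * R ^ 2)) :=
          Finset.sum_le_sum fun p _ => h.measureReal_abs_sum_gt_le _ k p.2 ha
      _ = _ := by simp; ring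
  rw [probReal_compl_eq_one_sub hmeas] at hle
  linarith

/-- The exploration length is chosen so that some average exceeds `ε` with probability at most `δ`; for
the threshold `2 ε` the failure probability drops to `δ / 2`, which leaves room for a second
event. -/
lemma IsSubGaussianNoise.one_sub_half_le_measureReal_noiseEvent {m n : ℕ} (hm : 0 < m)
    (hn : 0 < n) {Ω : Type*} [MeasurableSpace Ω] {μ : Measure Ω} [IsProbabilityMeasure μ]
    {ξ : ℕ → Ω → Fin n → ℝ} {R δ : ℝ} (h : IsSubGaussianNoise μ ξ R) (hR : 0 < R) (hδ₀ : 0 < δ)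
    (hδ₁ : δ < 1) {k : ℕ} (hk : 0 < k) {ε : ℝ} (hε : 0 < ε)
    (hkε : (1 / ε) ^ 2 * (2 * R ^ 2 * Real.log (2 * m * n / δ)) ≤ k) :
    1 - δ / 2 ≤ μ.real (noiseEvent m ξ k (k * (2 * ε))) := by
  have hk' : (0 : ℝ) < k := by exact_mod_cast hk
  have hm' : (1 : ℝ) ≤ m := by exact_mod_cast hm
  have hn' : (1 : ℝ) ≤ n := by exact_mod_cast hn
  set l : ℝ := 2 * m * n / δ with hl
  have hl2 : 2 ≤ l := by
    rw [hl, le_div_iff₀ hδ₀]; nlinarith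
  refine le_trans ?_ (h.le_measureReal_noiseEvent m k (by positivity))
  have hexp : -(k * (2 * ε)) ^ 2 / (2 * k * R ^ 2) ≤ -(2 * Real.log l) := by
    have h1 : 2 * R ^ 2 * Real.log l ≤ k * ε ^ 2 := by
      have := mul_le_mul_of_nonneg_right hkε (sq_nonneg ε)
      field_simp at this
      linarith
    rw [neg_div, neg_le_neg_iff, le_div_iff₀ (by positivity)]
    have h2 := mul_le_mul_of_nonneg_left h1 hk'.le
    have h3 : 0 ≤ (k : ℝ) * (k * ε ^ 2) := by positivity
    linarith
  have hexp' : Real.exp (-(k * (2 * ε)) ^ 2 / (2 * k * R ^ 2)) ≤ (l ^ 2)⁻¹ := by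
    refine (Real.exp_le_exp.2 hexp).trans_eq ?_
    rw [Real.exp_neg, two_mul, Real.exp_add, Real.exp_log (by linarith), sq]
  have hfin : 2 * m * n * (l ^ 2)⁻¹ ≤ δ / 2 := by
    have h1 : 2 * m * n = δ * l := by rw [hl]; field_simp
    rw [h1, ← div_eq_mul_inv, div_le_div_iff₀ (by positivity) two_pos]
    have h2 : 0 ≤ δ * l * (l - 2) := by
      have : 0 ≤ l - 2 := by linarith
      positivity
    linarith
  have := mul_le_mul_of_nonneg_left hexp' (show 0 ≤ 2 * (m : ℝ) * n by positivity)
  linarith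

/-! ### Conditional expectation bound and tail bound -/

/-- If `S ≤ b + Z` on `E` with `Z ≥ 0` of small mean, then the mean of `S` given `E` is small. -/
lemma integral_cond_le {Ω : Type*} [MeasurableSpace Ω] {μ : Measure Ω} [IsProbabilityMeasure μ]
    {E : Set Ω} (hE : MeasurableSet E) {p : ℝ} (hp : 0 < p) (hpE : p ≤ μ.real E) {S Z : Ω → ℝ}
    {b z : ℝ} (hS : Integrable S μ) (hZ : Integrable Z μ) (hZ₀ : ∀ ω, 0 ≤ Z ω)
    (hz : ∫ ω, Z ω ∂μ ≤ z) (hSZ : ∀ ω ∈ E, S ω ≤ b + Z ω) :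
    ∫ ω, S ω ∂(μ[|E]) ≤ b + z / p := by
  have hpos : 0 < μ.real E := hp.trans_le hpE
  rw [ProbabilityTheory.cond, integral_smul_measure, ENNReal.toReal_inv, smul_eq_mul,
    ← measureReal_def]
  have hbZ : Integrable (fun ω => b + Z ω) μ := (integrable_const b).add hZ
  have h1 : ∫ ω in E, S ω ∂μ ≤ ∫ ω in E, (b + Z ω) ∂μ :=
    setIntegral_mono_on hS.integrableOn hbZ.integrableOn hE hSZ
  have h2 : ∫ ω in E, (b + Z ω) ∂μ = μ.real E * b + ∫ ω in E, Z ω ∂μ := by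
    rw [integral_add (integrable_const b) hZ.integrableOn]
    simp
  have h3 : ∫ ω in E, Z ω ∂μ ≤ z :=
    (setIntegral_le_integral hZ (Eventually.of_forall hZ₀)).trans hz
  have hz₀ : 0 ≤ z := (integral_nonneg hZ₀).trans hz
  calc (μ.real E)⁻¹ * ∫ ω in E, S ω ∂μ ≤ (μ.real E)⁻¹ * (μ.real E * b + z) :=
        mul_le_mul_of_nonneg_left (by linarith) (inv_nonneg.2 hpos.le)
    _ = b + z / μ.real E := by field_simp
    _ ≤ b + z / p := by gcongr

/-- If `S ≤ b + Z` on `E` with `Z ≥ 0` of small mean, then `S` is small with high probability. -/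
lemma one_sub_le_measureReal_of_le_add {Ω : Type*} [MeasurableSpace Ω] {μ : Measure Ω}
    [IsProbabilityMeasure μ] {E : Set Ω} {p : ℝ} (hp : 0 < p)
    (hpE : 1 - p ≤ μ.real E) {S Z : Ω → ℝ} {b z : ℝ} (hZ : Integrable Z μ) (hZ₀ : ∀ ω, 0 ≤ Z ω)
    (hz₀ : 0 < z) (hz : ∫ ω, Z ω ∂μ ≤ z) (hSZ : ∀ ω ∈ E, S ω ≤ b + Z ω) :
    1 - 2 * p ≤ μ.real {ω | S ω ≤ b + z / p} := by
  have hmarkov : μ.real {ω | z / p ≤ Z ω} ≤ p := by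
    have h1 := mul_meas_ge_le_integral_of_nonneg (Eventually.of_forall hZ₀) hZ (z / p)
    have h2 : z / p * μ.real {ω | z / p ≤ Z ω} ≤ z / p * p := by
      rw [div_mul_cancel₀ _ hp.ne']; exact h1.trans hz
    exact le_of_mul_le_mul_left h2 (by positivity)
  have hsub : E ⊆ {ω | S ω ≤ b + z / p} ∪ {ω | z / p ≤ Z ω} := by
    intro ω hω
    rcases le_total (z / p) (Z ω) with h | h
    · exact Or.inr h
    · exact Or.inl ((hSZ ω hω).trans (by linarith))
  have := (measureReal_mono (μ := μ) hsub).trans (measureReal_union_le _ _)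
  linarith

/-! ### Regrets along an explore-then-commit trajectory -/

lemma sum_payoff {m n : ℕ} (B : Matrix (Fin m) (Fin n) ℝ) (T : ℕ) (x : ℕ → Fin m → ℝ)
    (z : Fin n → ℝ) :
    ∑ t ∈ Finset.range T, payoff B (x t) z = payoff B (∑ t ∈ Finset.range T, x t) z := by
  simp only [payoff, sum_dotProduct]

lemma bddAbove_payoff {m n : ℕ} (B : Matrix (Fin m) (Fin n) ℝ) (x : Fin m → ℝ) :
    BddAbove (Set.range fun z : stdSimplex ℝ (Fin n) => payoff B x z) := by
  refine ⟨⨆ j, (x ᵥ* B) j, ?_⟩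
  rintro _ ⟨z, rfl⟩
  exact payoff_le_of_forall z.2 fun j => le_ciSup (Set.finite_range (x ᵥ* B)).bddAbove j

/-- The best fixed mixed action in hindsight is as good as the best pure one. -/
lemma iSup_payoff {m n : ℕ} (hn : 0 < n) (B : Matrix (Fin m) (Fin n) ℝ) (x : Fin m → ℝ) :
    ⨆ z : stdSimplex ℝ (Fin n), payoff B x z = ⨆ j, (x ᵥ* B) j := by
  have : Nonempty (Fin n) := ⟨⟨0, hn⟩⟩
  have : Nonempty (stdSimplex ℝ (Fin n)) := ⟨⟨_, single_mem_stdSimplex ℝ ⟨0, hn⟩⟩⟩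
  refine le_antisymm (ciSup_le fun z => payoff_le_of_forall z.2 fun j =>
    le_ciSup (Set.finite_range (x ᵥ* B)).bddAbove j) (ciSup_le fun j => ?_)
  rw [← payoff_single]
  exact le_ciSup (bddAbove_payoff B x) ⟨_, single_mem_stdSimplex ℝ j⟩

lemma le_learnerRegret {m n : ℕ} (B : Matrix (Fin m) (Fin n) ℝ) (T : ℕ) (x : ℕ → Fin m → ℝ)
    (y : ℕ → Fin n → ℝ) (i : Fin n) :
    ∑ t ∈ Finset.range T, ((x t ᵥ* B) i - payoff B (x t) (y t)) ≤ learnerRegret B T x y := by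
  rw [learnerRegret, Finset.sum_sub_distrib]
  refine sub_le_sub_right ?_ _
  have h : payoff B (∑ t ∈ Finset.range T, x t) (Pi.single i 1) ≤ _ :=
    le_ciSup (bddAbove_payoff B (∑ t ∈ Finset.range T, x t)) ⟨_, single_mem_stdSimplex ℝ i⟩
  simp only [← sum_payoff] at h
  simpa only [payoff_single] using h

lemma sum_range_ite_lt_le (N T : ℕ) :
    ∑ t ∈ Finset.range T, (if t < N then (1 : ℝ) else 0) ≤ N := by
  rw [Finset.sum_ite, Finset.sum_const_zero, add_zero, Finset.sum_const, nsmul_eq_mul, mul_one]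
  have : (Finset.range T).filter (· < N) ⊆ Finset.range N := fun t ht => by
    simpa using (Finset.mem_filter.1 ht).2
  exact_mod_cast (Finset.card_le_card this).trans_eq (Finset.card_range N)

/-- If the optimizer commits to `u` after `N` rounds and `i` beats the other responses to `u` by
`D`, the mass that the learner puts on other actions after round `N` is paid for by regret. -/
lemma mul_sum_le_learnerRegret {m n : ℕ} (B : Matrix (Fin m) (Fin n) ℝ) {T N : ℕ}
    {x : ℕ → Fin m → ℝ} {y : ℕ → Fin n → ℝ} (hx : ∀ t, x t ∈ stdSimplex ℝ (Fin m))
    (hy : ∀ t, y t ∈ stdSimplex ℝ (Fin n)) {u : Fin m → ℝ}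
    (hu : ∀ t < T, N ≤ t → x t = u) (i : Fin n) {D : ℝ}
    (hD : ∀ j, j ≠ i → (u ᵥ* B) j - (u ᵥ* B) i ≤ -D) :
    D * ∑ t ∈ Finset.range T, (if t < N then 0 else 1 - y t i)
      ≤ learnerRegret B T x y + 2 * absSum B * N := by
  have hβ := absSum_nonneg B
  have h1 : ∀ t ∈ Finset.range T, D * (if t < N then 0 else 1 - y t i)
      ≤ ((x t ᵥ* B) i - payoff B (x t) (y t))
        + 2 * absSum B * (if t < N then (1 : ℝ) else 0) := by
    intro t ht
    split_ifs with htN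
    · have h1 := abs_le.1 (abs_vecMul_le B (hx t) i)
      have h2 := abs_le.1 (abs_payoff_le B (hx t) (hy t))
      linarith
    · rw [hu t (Finset.mem_range.1 ht) (not_lt.1 htN)]
      have := le_sub_payoff B (hy t) i hD
      linarith
  have h2 := Finset.sum_le_sum h1
  rw [← Finset.mul_sum, Finset.sum_add_distrib, ← Finset.mul_sum] at h2
  have h3 := le_learnerRegret B T x y i
  have h4 := mul_le_mul_of_nonneg_left (sum_range_ite_lt_le N T)
    (show 0 ≤ 2 * absSum B by positivity)
  linarith

/-- Against an optimizer that eventually commits, regret is negative at most by the payoff of the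
rounds before the commitment. -/
lemma learnerRegret_add_nonneg {m n : ℕ} (hn : 0 < n) (B : Matrix (Fin m) (Fin n) ℝ) {T N : ℕ}
    {x : ℕ → Fin m → ℝ} {y : ℕ → Fin n → ℝ} (hx : ∀ t, x t ∈ stdSimplex ℝ (Fin m))
    (hy : ∀ t, y t ∈ stdSimplex ℝ (Fin n)) {u : Fin m → ℝ}
    (hu : ∀ t < T, N ≤ t → x t = u) :
    0 ≤ learnerRegret B T x y + 2 * absSum B * N := by
  have : Nonempty (Fin n) := ⟨⟨0, hn⟩⟩
  obtain ⟨i, hi⟩ := Finite.exists_max (u ᵥ* B)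
  have h := mul_sum_le_learnerRegret B hx hy hu i (D := 0) fun j _ => by linarith [hi j]
  rwa [zero_mul] at h

lemma learnerRegret_le {m n : ℕ} (hn : 0 < n) (B : Matrix (Fin m) (Fin n) ℝ) (T : ℕ)
    {x : ℕ → Fin m → ℝ} {y : ℕ → Fin n → ℝ} (hx : ∀ t, x t ∈ stdSimplex ℝ (Fin m))
    (hy : ∀ t, y t ∈ stdSimplex ℝ (Fin n)) : learnerRegret B T x y ≤ 2 * absSum B * T := by
  have : Nonempty (stdSimplex ℝ (Fin n)) := ⟨⟨_, single_mem_stdSimplex ℝ ⟨0, hn⟩⟩⟩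
  have h1 : ⨆ z : stdSimplex ℝ (Fin n), ∑ t ∈ Finset.range T, payoff B (x t) z
      ≤ T * absSum B := by
    refine ciSup_le fun z => ?_
    calc _ ≤ ∑ _t ∈ Finset.range T, absSum B :=
          Finset.sum_le_sum fun t _ => (le_abs_self _).trans (abs_payoff_le B (hx t) z.2)
      _ = _ := by simp
  have h2 : -(T * absSum B) ≤ ∑ t ∈ Finset.range T, payoff B (x t) (y t) := by
    calc -(T * absSum B) = ∑ _t ∈ Finset.range T, -absSum B := by simp
      _ ≤ _ := Finset.sum_le_sum fun t _ => (abs_le.1 (abs_payoff_le B (hx t) (hy t))).1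
  rw [learnerRegret]
  linarith

lemma stackelbergRegret_le {m n : ℕ} (A B : Matrix (Fin m) (Fin n) ℝ) {T N : ℕ}
    {x : ℕ → Fin m → ℝ} {y : ℕ → Fin n → ℝ} (hx : ∀ t, x t ∈ stdSimplex ℝ (Fin m))
    (hy : ∀ t, y t ∈ stdSimplex ℝ (Fin n)) {u : Fin m → ℝ}
    (hu : ∀ t < T, N ≤ t → x t = u) (i : Fin n) {τ : ℝ} (hτ : 0 ≤ τ)
    (hV : stackelbergValue A B ≤ absSum A) (hVu : stackelbergValue A B ≤ (u ᵥ* A) i + τ) :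
    stackelbergRegret A B T x y ≤ 2 * absSum A * N + T * τ
      + 2 * absSum A * ∑ t ∈ Finset.range T, (if t < N then 0 else 1 - y t i) := by
  have hα := absSum_nonneg A
  have h1 : ∀ t ∈ Finset.range T, stackelbergValue A B - payoff A (x t) (y t)
      ≤ 2 * absSum A * (if t < N then (1 : ℝ) else 0) + τ
        + 2 * absSum A * (if t < N then 0 else 1 - y t i) := by
    intro t ht
    split_ifs with htN
    · have h2 := abs_le.1 (abs_payoff_le A (hx t) (hy t))
      linarith
    · have hxu := hu t (Finset.mem_range.1 ht) (not_lt.1 htN)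
      have := sub_payoff_le A (hx t) (hy t) i
      rw [hxu] at this ⊢
      linarith
  have h2 := Finset.sum_le_sum h1
  rw [Finset.sum_add_distrib, Finset.sum_add_distrib, ← Finset.mul_sum, ← Finset.mul_sum,
    Finset.sum_sub_distrib, Finset.sum_const, Finset.sum_const, Finset.card_range, nsmul_eq_mul,
    nsmul_eq_mul] at h2
  have h4 := mul_le_mul_of_nonneg_left (sum_range_ite_lt_le N T)
    (show 0 ≤ 2 * absSum A by positivity)
  rw [stackelbergRegret]
  linarith

/-! ### Integrability -/

lemma measurable_payoff {m n : ℕ} {Ω : Type*} [MeasurableSpace Ω] (M : Matrix (Fin m) (Fin n) ℝ)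
    {x : Ω → Fin m → ℝ} {y : Ω → Fin n → ℝ} (hx : Measurable x) (hy : Measurable y) :
    Measurable fun ω => payoff M (x ω) (y ω) := by
  simp only [payoff_eq_sum, Matrix.vecMul, dotProduct]
  fun_prop

lemma integrable_stackelbergRegret {m n : ℕ} {Ω : Type*} [MeasurableSpace Ω] {μ : Measure Ω}
    [IsProbabilityMeasure μ] (A B : Matrix (Fin m) (Fin n) ℝ) (T : ℕ)
    {x : ℕ → Ω → Fin m → ℝ} {y : ℕ → Ω → Fin n → ℝ} (hxm : ∀ t, Measurable (x t))
    (hym : ∀ t, Measurable (y t)) (hx : ∀ t ω, x t ω ∈ stdSimplex ℝ (Fin m))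
    (hy : ∀ t ω, y t ω ∈ stdSimplex ℝ (Fin n)) :
    Integrable (fun ω => stackelbergRegret A B T (fun t => x t ω) (fun t => y t ω)) μ := by
  refine (integrable_const _).sub (integrable_finsetSum _ fun t _ => ?_)
  exact Integrable.of_bound (measurable_payoff A (hxm t) (hym t)).aestronglyMeasurable (absSum A)
    (Eventually.of_forall fun ω => abs_payoff_le A (hx t ω) (hy t ω))

lemma integrable_learnerRegret {m n : ℕ} (hn : 0 < n) {Ω : Type*} [MeasurableSpace Ω]
    {μ : Measure Ω} [IsProbabilityMeasure μ] (B : Matrix (Fin m) (Fin n) ℝ) (T : ℕ)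
    {x : ℕ → Ω → Fin m → ℝ} {y : ℕ → Ω → Fin n → ℝ} (hxm : ∀ t, Measurable (x t))
    (hym : ∀ t, Measurable (y t)) (hx : ∀ t ω, x t ω ∈ stdSimplex ℝ (Fin m))
    (hy : ∀ t ω, y t ω ∈ stdSimplex ℝ (Fin n)) :
    Integrable (fun ω => learnerRegret B T (fun t => x t ω) (fun t => y t ω)) μ := by
  have hmeas : Measurable fun ω => learnerRegret B T (fun t => x t ω) (fun t => y t ω) := by
    simp only [learnerRegret, sum_payoff, iSup_payoff hn]
    refine Measurable.sub (Measurable.iSup fun j => ?_)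
      (Finset.measurable_sum _ fun t _ => measurable_payoff B (hxm t) (hym t))
    simp only [Matrix.vecMul, dotProduct, Finset.sum_apply]
    fun_prop
  refine Integrable.of_bound hmeas.aestronglyMeasurable (2 * absSum B * T)
    (Eventually.of_forall fun ω => abs_le.2 ⟨?_, learnerRegret_le hn B T (fun t => hx t ω)
      fun t => hy t ω⟩)
  have := learnerRegret_add_nonneg hn B (N := T) (fun t => hx t ω) (fun t => hy t ω) (u := 0)
    fun t (h1 : t < T) (h2 : T ≤ t) => (h1.not_ge h2).elim
  linarith

/-! ### The explore-then-commit algorithm -/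

lemma exploreCommitAct_explore {m n : ℕ} (ψ : (Fin n → ℝ) → ℝ) (η : ℕ → ℝ) {k : ℕ}
    (commit : Matrix (Fin m) (Fin n) ℝ → stdSimplex ℝ (Fin m)) (h : ℕ → Fin n → ℝ)
    (r : Fin m) {s : ℕ} (hs : s < k) :
    exploreCommitAct ψ η k commit (r * (k + 1) + s) h = Pi.single r 1 := by
  have hi : ((r : ℕ) + 1) * (k + 1) ≤ m * (k + 1) := Nat.mul_le_mul_right _ r.2
  have he : ((r : ℕ) + 1) * (k + 1) = (r : ℕ) * (k + 1) + (k + 1) := by ring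
  have hdiv : ((r : ℕ) * (k + 1) + s) / (k + 1) = r := by
    rw [mul_comm, Nat.mul_add_div (Nat.succ_pos k), Nat.div_eq_of_lt (by omega), add_zero]
  rw [exploreCommitAct, dif_pos (by omega)]
  congr 1
  exact Fin.ext hdiv

lemma exploreCommitAct_commit {m n : ℕ} (ψ : (Fin n → ℝ) → ℝ) (η : ℕ → ℝ) {k : ℕ}
    (commit : Matrix (Fin m) (Fin n) ℝ → stdSimplex ℝ (Fin m)) (h : ℕ → Fin n → ℝ)
    {t : ℕ} (ht : m * (k + 1) ≤ t) :
    exploreCommitAct ψ η k commit t h = commit (estimate m ψ η k h) := by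
  rw [exploreCommitAct, dif_neg (not_lt.2 ht)]

/-- When the exploration noise averages to at most `2 ε`, the class matrices of the estimate are
`8 ε / spread B`-close to the true ones; a commitment margin that exceeds this by `D` makes the
learner's regret control the Stackelberg regret. -/
lemma IsPlay.stackelbergRegret_le_of_mem_noiseEvent {m n : ℕ} (hm : 0 < m) (hn : 0 < n)
    {A B : Matrix (Fin m) (Fin n) ℝ} {κ : ℝ} (hκ : 0 < κ)
    (hne : ∀ i x, x ∈ pessimisticFacet B i 0 → (pessimisticFacet B i κ).Nonempty)
    (hs : 0 < spread B) {k : ℕ} (hk : 0 < k) {ε d D : ℝ} (hε : 0 < ε) (hD : 0 < D)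
    (hDd : D + 8 * ε / spread B ≤ d) (hdκ : d + 8 * ε / spread B ≤ κ)
    {Ω : Type*} [MeasurableSpace Ω] {learner : MirrorAscent n} {ξ : ℕ → Ω → Fin n → ℝ}
    {commit : Matrix (Fin m) (Fin n) ℝ → stdSimplex ℝ (Fin m)} {hcommit : Measurable commit}
    {x : ℕ → Ω → Fin m → ℝ} {y : ℕ → Ω → Fin n → ℝ}
    (hsolve : ∀ B' : Matrix (Fin m) (Fin n) ℝ, (∃ i, (pessimisticFacet B' i d).Nonempty) →
      SolvesPessimistic A B' d (commit B'))
    (h : IsPlay B learner ξ (exploreCommit learner.ψ learner.η k commit hcommit) x y)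
    (T : ℕ) {ω : Ω} (hω : ω ∈ noiseEvent m ξ k (k * (2 * ε))) :
    stackelbergRegret A B T (fun t => x t ω) (fun t => y t ω)
      ≤ 2 * absSum A * (m * (k + 1) : ℕ) + T * (2 * absSum A * ((d + 8 * ε / spread B) / κ))
        + 2 * absSum A / (D * spread B) * (learnerRegret B T (fun t => x t ω) (fun t => y t ω)
          + 2 * absSum B * (m * (k + 1) : ℕ)) := by
  have hk' : (0 : ℝ) < k := by exact_mod_cast hk
  have ha : 0 < 8 * ε / spread B := by positivity
  have hα := absSum_nonneg A
  have hx : ∀ t, x t ω ∈ stdSimplex ℝ (Fin m) := fun t => by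
    rw [h.optimizer]; exact OptimizerAlgorithm.act_mem _ _ _
  have hy : ∀ t, y t ω ∈ stdSimplex ℝ (Fin n) := fun t => (h.mem_openSimplex t ω).1
  set Bh := estimate m learner.ψ learner.η k (fun t => y t ω) with hBh
  have hxe : ∀ (r : Fin m) (s : ℕ), s < k → x (r * (k + 1) + s) ω = Pi.single r 1 :=
    fun r s hsk => by
      rw [h.optimizer]; exact exploreCommitAct_explore _ _ commit _ r hsk
  have hu : ∀ t < T, m * (k + 1) ≤ t → x t ω = (commit Bh : Fin m → ℝ) := fun t _ ht => by
    rw [h.optimizer]; exact exploreCommitAct_commit _ _ commit _ ht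
  have hdiff : ∀ r j i, |(Bh r j - Bh r i) - (B r j - B r i)| ≤ 4 * ε := by
    intro r j i
    rw [hBh, h.estimate_sub hk ω hxe r i j, add_sub_cancel_left, abs_div, abs_of_pos hk',
      div_le_iff₀ hk']
    have := (abs_sub _ _).trans (add_le_add (hω r j) (hω r i))
    linarith
  have hclose : ∀ i r (j : {j : Fin n // j ≠ i}),
      |classMatrix Bh i r j - classMatrix B i r j| ≤ 8 * ε / spread B := fun i r j => by
    have := abs_classMatrix_sub_le (by positivity) hdiff hs i r j
    rwa [show 2 * (4 * ε) = 8 * ε by ring] at this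
  obtain ⟨i, hi, hV⟩ := SolvesPessimistic.mem_and_value_le hm hn hκ hne (by linarith) hdκ hclose
    (hsolve Bh)
  have hgap := vecMul_sub_le_of_mem_pessimisticFacet hs
    (pessimisticFacet_anti B i (show D ≤ d - 8 * ε / spread B by linarith) hi)
  have h1 := stackelbergRegret_le A B hx hy hu i
    (mul_nonneg (mul_nonneg zero_le_two hα) (div_nonneg (by linarith) hκ.le))
    (stackelbergValue_le_absSum hm hn A B) hV
  have h2 := mul_sum_le_learnerRegret B hx hy hu i hgap
  have hDs : 0 < D * spread B := by positivity
  rw [mul_comm, ← le_div_iff₀ hDs] at h2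
  have h3 := mul_le_mul_of_nonneg_left h2 (show 0 ≤ 2 * absSum A by positivity)
  refine h1.trans (add_le_add_right (h3.trans_eq ?_) _)
  field_simp

/-- Both bounds on the Stackelberg regret at a fixed horizon. -/
lemma IsPlay.stackelbergRegret_bounds {m n : ℕ} (hm : 0 < m) (hn : 0 < n)
    {A B : Matrix (Fin m) (Fin n) ℝ} {κ : ℝ} (hκ : 0 < κ)
    (hne : ∀ i x, x ∈ pessimisticFacet B i 0 → (pessimisticFacet B i κ).Nonempty)
    (hs : 0 < spread B) {R δ : ℝ} (hR : 0 < R) (hδ₀ : 0 < δ) (hδ₁ : δ < 1)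
    {k : ℕ} (hk : 0 < k) {ε d D : ℝ} (hε : 0 < ε) (hD : 0 < D)
    (hkε : (1 / ε) ^ 2 * (2 * R ^ 2 * Real.log (2 * m * n / δ)) ≤ k)
    (hDd : D + 8 * ε / spread B ≤ d) (hdκ : d + 8 * ε / spread B ≤ κ)
    {Ω : Type*} [MeasurableSpace Ω] {μ : Measure Ω} [IsProbabilityMeasure μ]
    {learner : MirrorAscent n} {ξ : ℕ → Ω → Fin n → ℝ}
    {commit : Matrix (Fin m) (Fin n) ℝ → stdSimplex ℝ (Fin m)} {hcommit : Measurable commit}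
    {x : ℕ → Ω → Fin m → ℝ} {y : ℕ → Ω → Fin n → ℝ}
    (hnoise : IsSubGaussianNoise μ ξ R) {T : ℕ} {ρ : ℝ}
    (hreg : HasRegretAtMost μ B learner ξ T ρ)
    (hsolve : ∀ B' : Matrix (Fin m) (Fin n) ℝ, (∃ i, (pessimisticFacet B' i d).Nonempty) →
      SolvesPessimistic A B' d (commit B'))
    (h : IsPlay B learner ξ (exploreCommit learner.ψ learner.η k commit hcommit) x y)
    {b z : ℝ}
    (hb : 2 * absSum A * (m * (k + 1) : ℕ)
      + T * (2 * absSum A * ((d + 8 * ε / spread B) / κ)) ≤ b) (hz₀ : 0 < z)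
    (hz : 2 * absSum A / (D * spread B) * (ρ + 2 * absSum B * (m * (k + 1) : ℕ)) ≤ z) :
    (∃ E : Set Ω,
      MeasurableSet[⨆ t : Fin (m * (k + 1)), MeasurableSpace.comap (ξ t) inferInstance] E ∧
      1 - δ ≤ μ.real E ∧
      ∫ ω, stackelbergRegret A B T (fun t => x t ω) (fun t => y t ω) ∂(μ[|E])
        ≤ b + z / (δ / 2) + z / (1 - δ / 2)) ∧
    1 - δ ≤ μ.real {ω | stackelbergRegret A B T (fun t => x t ω) (fun t => y t ω)
      ≤ b + z / (δ / 2) + z / (1 - δ / 2)} := by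
  have hα := absSum_nonneg A
  have hDs : 0 < D * spread B := by positivity
  have hc : 0 ≤ 2 * absSum A / (D * spread B) := by positivity
  have hx : ∀ t ω, x t ω ∈ stdSimplex ℝ (Fin m) := fun t ω => by
    rw [h.optimizer]; exact OptimizerAlgorithm.act_mem _ _ _
  have hy : ∀ t ω, y t ω ∈ stdSimplex ℝ (Fin n) := fun t ω => (h.mem_openSimplex t ω).1
  have hxm : ∀ t, Measurable (x t) := fun t => by
    rw [show x t = _ from funext (h.optimizer t)]
    exact (OptimizerAlgorithm.measurable_act _ t).comp (measurable_pi_lambda _ h.measurable_y)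
  set Z : Ω → ℝ := fun ω => 2 * absSum A / (D * spread B) *
    (learnerRegret B T (fun t => x t ω) (fun t => y t ω)
      + 2 * absSum B * (m * (k + 1) : ℕ)) with hZ
  have hS := integrable_stackelbergRegret (μ := μ) A B T hxm h.measurable_y hx hy
  have hL := integrable_learnerRegret (μ := μ) hn B T hxm h.measurable_y hx hy
  have hZi : Integrable Z μ := (hL.add (integrable_const _)).const_mul _
  have hZ₀ : ∀ ω, 0 ≤ Z ω := fun ω =>
    mul_nonneg hc (learnerRegret_add_nonneg hn B (fun t => hx t ω) (fun t => hy t ω)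
      fun t _ ht => by rw [h.optimizer]; exact exploreCommitAct_commit _ _ commit _ ht)
  have hZz : ∫ ω, Z ω ∂μ ≤ z := by
    refine le_trans ?_ hz
    rw [hZ, integral_const_mul, integral_add hL (integrable_const _)]
    refine mul_le_mul_of_nonneg_left (add_le_add (hreg _ x y h) ?_) hc
    simp
  have hSZ : ∀ ω ∈ noiseEvent m ξ k (k * (2 * ε)),
      stackelbergRegret A B T (fun t => x t ω) (fun t => y t ω) ≤ b + Z ω := fun ω hω =>
    (h.stackelbergRegret_le_of_mem_noiseEvent hm hn hκ hne hs hk hε hD hDd hdκ hsolve T hω).trans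
      (add_le_add_left hb _)
  have hE := hnoise.one_sub_half_le_measureReal_noiseEvent hm hn hR hδ₀ hδ₁ hk hε hkε
  have h1 : 0 ≤ z / (δ / 2) := by positivity
  have h2 : 0 ≤ z / (1 - δ / 2) := div_nonneg hz₀.le (by linarith)
  refine ⟨⟨_, measurableSet_noiseEvent m ξ k (k * (2 * ε)), by linarith, ?_⟩, ?_⟩
  · have := integral_cond_le (iSup_comap_le hnoise.measurable _
      (measurableSet_noiseEvent m ξ k (k * (2 * ε)))) (by linarith) hE hS hZi hZ₀ hZz hSZ
    linarith
  · have := one_sub_le_measureReal_of_le_add (by positivity) hE hZi hZ₀ hz₀ hZz hSZ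
    rw [show 2 * (δ / 2) = δ by ring] at this
    refine this.trans (measureReal_mono fun ω hω => ?_)
    rw [Set.mem_ofPred_eq] at hω ⊢
    linarith

end Steering

theorem mainTheorem4 {m n : ℕ} (hm : 0 < m) (hn : 2 ≤ n)
    (A B : Matrix (Fin m) (Fin n) ℝ) (hgap : ∀ i, Steering.inducibilityGap B i ≠ 0)
    (C R δ c M : ℝ) (hR : 0 < R) (hδ₀ : 0 < δ) (hδ₁ : δ < 1)
    (hc : 8 * n / Steering.spread B ≤ c) (hM : 0 < M) :
    ∃ K : ℝ, ∀ f g : ℕ → ℝ,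
      f =o[atTop] (fun T : ℕ => (T : ℝ)) → g =o[atTop] (fun T : ℕ => (T : ℝ)) →
      (∀ᶠ T in atTop, 0 < g T) → (∀ᶠ T : ℕ in atTop, ((T : ℝ) / g T) ^ 2 ≤ M * f T) →
      ∃ T₀ : ℕ, ∀ T ≥ T₀,
        ∀ {Ω : Type*} [MeasurableSpace Ω] (μ : Measure Ω) [IsProbabilityMeasure μ]
          (learner : Steering.MirrorAscent n) (ξ : ℕ → Ω → Fin n → ℝ)
          (commit : Matrix (Fin m) (Fin n) ℝ → stdSimplex ℝ (Fin m))
          (hcommit : Measurable commit)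
          (x : ℕ → Ω → Fin m → ℝ) (y : ℕ → Ω → Fin n → ℝ),
          Steering.IsSubGaussianNoise μ ξ R →
          Steering.HasRegretAtMost μ B learner ξ T (C * f T) →
          (∀ B' : Matrix (Fin m) (Fin n) ℝ,
            (∃ i, (Steering.pessimisticFacet B' i (Steering.commitMargin c f g T)).Nonempty) →
            Steering.SolvesPessimistic A B' (Steering.commitMargin c f g T) (commit B')) →
          Steering.IsPlay B learner ξ
            (Steering.exploreCommit learner.ψ learner.η (Steering.exploreLength m n R δ g T)
              commit hcommit) x y →
          (∃ E : Set Ω,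
            MeasurableSet[⨆ t : Fin (m * (Steering.exploreLength m n R δ g T + 1)),
              MeasurableSpace.comap (ξ t) inferInstance] E ∧
            1 - δ ≤ μ.real E ∧
            ∫ ω, Steering.stackelbergRegret A B T (fun t => x t ω) (fun t => y t ω) ∂(μ[|E])
              ≤ K * (√(T * f T) + g T + ((T : ℝ) / g T) ^ 2)) ∧
          1 - δ ≤ μ.real {ω |
            Steering.stackelbergRegret A B T (fun t => x t ω) (fun t => y t ω)
              ≤ K * (√(T * f T) + g T + ((T : ℝ) / g T) ^ 2)} := by
  have hn₀ : 0 < n := by omega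
  have hs : 0 < Steering.spread B := Steering.spread_pos (hgap ⟨0, hn₀⟩)
  obtain ⟨κ, hκ, hne⟩ := Steering.exists_uniform_gap hn hgap
  have hm' : (1 : ℝ) ≤ m := by exact_mod_cast hm
  have hn' : (2 : ℝ) ≤ n := by exact_mod_cast hn
  set s := Steering.spread B with hs_def
  set α := Steering.absSum A with hα_def
  set β := Steering.absSum B with hβ_def
  have hα : 0 ≤ α := Steering.absSum_nonneg A
  have hβ : 0 ≤ β := Steering.absSum_nonneg B
  set l := 2 * R ^ 2 * Real.log (2 * m * n / δ) with hl_def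
  have hl : 0 < l := by
    have : 1 < 2 * m * n / δ := by
      rw [lt_div_iff₀ hδ₀]; nlinarith
    have := Real.log_pos this
    positivity
  have hc16 : 16 / s ≤ c := by
    refine le_trans (div_le_div_of_nonneg_right ?_ hs.le) hc
    linarith
  have hs8 : 0 < 8 / s := by positivity
  have hcs : 8 / s + 8 / s = 16 / s := by ring
  have hc₀ : 0 < c := by linarith
  -- `N ≤ ν (T / g)²` exploration rounds; `z = ζ √(T f)` bounds the mean cost of the learner's regret
  set ν : ℝ := m * (l + 2) with hν_def
  have hν : 0 < ν := by positivity
  set ζ : ℝ := 2 * α / s * (|C| + 2 * β * (ν * M)) + 1 with hζ_def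
  have hζ : 0 < ζ := by positivity
  set θ : ℝ := c + 8 / s with hθ_def
  have hθ : 0 < θ := by positivity
  have hδ2 : 0 < 1 - δ / 2 := by linarith
  refine ⟨2 * α * ν + 2 * α / κ * (θ + 1) + (ζ / (δ / 2) + ζ / (1 - δ / 2)), ?_⟩
  intro f g hf hg hg₀ hfg
  have hev : ∀ᶠ T : ℕ in atTop, 0 < T ∧ 0 < g T ∧ ((T : ℝ) / g T) ^ 2 ≤ M * f T ∧ g T ≤ T ∧
      θ * g T ≤ κ / 2 * T ∧ f T ≤ (κ / 2) ^ 2 * T := by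
    have hκθ : 0 < κ / 2 / θ := by positivity
    have hκ2 : 0 < (κ / 2) ^ 2 := by positivity
    filter_upwards [eventually_gt_atTop 0, hg₀, hfg, hg.def one_pos, hg.def hκθ, hf.def hκ2]
      with T h1 h2 h3 h4 h5 h6
    rw [Real.norm_natCast, Real.norm_eq_abs] at h4 h5 h6
    have h5' := mul_le_mul_of_nonneg_left ((le_abs_self _).trans h5) hθ.le
    refine ⟨h1, h2, h3, by linarith [le_abs_self (g T)], h5'.trans_eq ?_,
      (le_abs_self _).trans h6⟩
    field_simp
  obtain ⟨T₀, hT₀⟩ := eventually_atTop.1 hev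
  refine ⟨T₀, fun T hT Ω _ μ _ learner ξ commit hcommit x y hnoise hreg hsolve hplay => ?_⟩
  obtain ⟨hT1, hgT, hqM, hgleT, hgκ, hfκ⟩ := hT₀ T hT
  have hTpos : (0 : ℝ) < T := by exact_mod_cast hT1
  set q : ℝ := ((T : ℝ) / g T) ^ 2 with hq_def
  have hq1 : 1 ≤ q := one_le_pow₀ ((one_le_div hgT).2 hgleT)
  have hf₀ : 0 < f T := pos_of_mul_pos_right (by linarith) hM.le
  set F : ℝ := √(T * f T) with hF_def
  have hF : 0 < F := Real.sqrt_pos.2 (by positivity)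
  have hFF : F * F = T * f T := Real.mul_self_sqrt (by positivity)
  set k := Steering.exploreLength m n R δ g T with hk_def
  have hkq : q * l ≤ k := Nat.le_ceil _
  have hk : 0 < k := by
    have : (0 : ℝ) < k := lt_of_lt_of_le (by positivity) hkq
    exact_mod_cast this
  have hN : ((m * (k + 1) : ℕ) : ℝ) ≤ ν * q := by
    have h1 : (k : ℝ) ≤ q * l + 1 := (Nat.ceil_lt_add_one (by positivity)).le
    have h2 : (k : ℝ) + 1 ≤ (l + 2) * q := by linarith
    push_cast
    rw [hν_def, mul_assoc]
    exact mul_le_mul_of_nonneg_left h2 (by linarith)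
  have hmargin : F / T + 8 * (g T / T) / s ≤ Steering.commitMargin c f g T := by
    have h1 : 8 / s * (g T / T) ≤ c * (g T / T) :=
      mul_le_mul_of_nonneg_right (by linarith) (by positivity)
    have h2 : 8 * (g T / T) / s = 8 / s * (g T / T) := by ring
    rw [Steering.commitMargin, ← hF_def]
    linarith
  have hmargin_eq : T * (Steering.commitMargin c f g T + 8 * (g T / T) / s) = θ * g T + F := by
    rw [Steering.commitMargin, ← hF_def, hθ_def]
    field_simp
    ring
  have hFκ : F ≤ κ / 2 * T := by
    rw [hF_def]
    refine Real.sqrt_le_iff.2 ⟨by positivity, ?_⟩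
    have := mul_le_mul_of_nonneg_left hfκ hTpos.le
    linarith
  have hmargin_le : Steering.commitMargin c f g T + 8 * (g T / T) / s ≤ κ := by
    refine le_of_mul_le_mul_left ?_ hTpos
    rw [hmargin_eq]
    linarith
  have hb : 2 * α * (m * (k + 1) : ℕ)
      + T * (2 * α * ((Steering.commitMargin c f g T + 8 * (g T / T) / s) / κ))
      ≤ 2 * α * ν * q + 2 * α / κ * (θ * g T + F) := by
    have h1 := mul_le_mul_of_nonneg_left hN (show 0 ≤ 2 * α by positivity)
    have h2 : T * (2 * α * ((Steering.commitMargin c f g T + 8 * (g T / T) / s) / κ))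
        = 2 * α / κ * (θ * g T + F) := by
      rw [← hmargin_eq]; ring
    linarith
  -- `T f / √(T f) = √(T f)` converts a regret of order `f` at margin `√(T f) / T`
  have hz : 2 * α / (F / T * s) * (C * f T + 2 * β * (m * (k + 1) : ℕ)) ≤ ζ * F := by
    have h1 : C * f T + 2 * β * (m * (k + 1) : ℕ) ≤ (|C| + 2 * β * (ν * M)) * f T := by
      have h2 := mul_le_mul_of_nonneg_right (le_abs_self C) hf₀.le
      have h3 := mul_le_mul_of_nonneg_left (hN.trans (mul_le_mul_of_nonneg_left hqM hν.le))
        (show 0 ≤ 2 * β by positivity)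
      linarith
    have h4 : 2 * α / (F / T * s) = 2 * α / s * (T / F) := by field_simp
    have h5 : T / F * f T = F := by
      rw [div_mul_eq_mul_div, ← hFF, mul_div_cancel_right₀ _ hF.ne']
    calc 2 * α / (F / T * s) * (C * f T + 2 * β * (m * (k + 1) : ℕ))
        ≤ 2 * α / s * (T / F) * ((|C| + 2 * β * (ν * M)) * f T) := by
          rw [h4]; exact mul_le_mul_of_nonneg_left h1 (by positivity)
      _ = 2 * α / s * (|C| + 2 * β * (ν * M)) * (T / F * f T) := by ring
      _ = (ζ - 1) * F := by rw [h5, hζ_def]; ring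
      _ ≤ ζ * F := by linarith
  have hkε : (1 / (g T / T)) ^ 2 * (2 * R ^ 2 * Real.log (2 * m * n / δ)) ≤ k := by
    rw [one_div_div]; exact hkq
  have key := hplay.stackelbergRegret_bounds hm hn₀ hκ hne hs hR hδ₀ hδ₁ hk
    (show 0 < g T / T by positivity) (show 0 < F / T by positivity) hkε hmargin hmargin_le hnoise
    hreg hsolve hb (mul_pos hζ hF) hz
  have hfinal : 2 * α * ν * q + 2 * α / κ * (θ * g T + F) + ζ * F / (δ / 2) + ζ * F / (1 - δ / 2)
      ≤ (2 * α * ν + 2 * α / κ * (θ + 1) + (ζ / (δ / 2) + ζ / (1 - δ / 2))) * (F + g T + q) := by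
    have e : (2 * α * ν + 2 * α / κ * (θ + 1) + (ζ / (δ / 2) + ζ / (1 - δ / 2))) * (F + g T + q)
        = 2 * α * ν * q + 2 * α / κ * (θ * g T + F) + ζ * F / (δ / 2) + ζ * F / (1 - δ / 2)
          + (2 * α * ν * (F + g T) + 2 * α / κ * (θ * (F + q) + (g T + q))
            + (ζ / (δ / 2) + ζ / (1 - δ / 2)) * (g T + q)) := by ring
    rw [e]
    have hpos : 0 ≤ 2 * α * ν * (F + g T) + 2 * α / κ * (θ * (F + q) + (g T + q))
        + (ζ / (δ / 2) + ζ / (1 - δ / 2)) * (g T + q) := by positivity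
    linarith
  obtain ⟨⟨E, hE, hE₁, hE₂⟩, hprob⟩ := key
  refine ⟨⟨E, hE, hE₁, hE₂.trans hfinal⟩, hprob.trans (measureReal_mono fun ω hω => ?_)⟩
  exact le_trans hω hfinal
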